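/- Theorem. Let $M$ be a connected smooth manifold of dimension $n\ge 1$ and let $F:TM\to[0,\infty)$ be a Finsler norm on $M$: $F$ is smooth on the slit tangent bundle $\widetilde{TM}=TM\setminus\{0\}$, $F(\lambda u)=\lambda F(u)$ for $\lambda>0$, and for each $u\in T_xM\setminus\{0\}$ the fundamental tensor $g_u(v,w)=\frac12\frac{\partial^2}{\partial t\,\partial s}F^2(u+tv+sw)\big|_{t=s=0}$ is positive definite on $T_xM$. For $u\in\widetilde{TM}$ and $X\in T_xM$ ($x$ the base point of $u$) let $X^v=\frac{d}{dt}\big|_{t=0}(u+tX)$ be the vertical lift, and let $X^h=\sum_i X^i\frac{\partial}{\partial x^i}-\sum_{i,j,k}\Gamma^i_{kj}X^ju^k\frac{\partial}{\partial u^i}$ be the horizontal lift of $X$ at $u$, where $\Gamma^i_{kj}$ are the Christoffel symbols of the Chern connection, i.e. of the unique connection $\nabla$ on the pullback bundle $\pi_0^*TM\to\widetilde{TM}$ that is torsion free and satisfies $Z(g(s_1,s_2))=g(\nabla_Zs_1,s_2)+g(s_1,\nabla_Zs_2)+2C(s_1,s_2,\nabla_Z\mathcal U)$, with $C$ the Cartan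 tensor, $C_u(v,w,z)=\frac14\frac{\partial^3}{\partial t\,\partial s\,\partial r}F^2(u+tv+sw+rz)\big|_{t=s=r=0}$, and $\mathcal U$ the canonical section, $\mathcal U(u)=u$. The geodesic vector field $\zeta$ on $\widetilde{TM}$ is the one whose value at $u$ is the horizontal lift $u^h$ of $u$ at $u$. Let $G$ be a smooth pseudo-Riemannian metric on $\widetilde{TM}$ that is $F$-natural: there are six functions $\alpha_i,\beta_i:(0,\infty)\to\mathbb R$, $i=1,2,3$, such that at every $u\in\widetilde{TM}$, with $r^2=F(u)^2$, for all $X,Y\in T_xM$, $$G(X^h,Y^h)=(\alpha_1+\alpha_3)(r^2)\,g_u(X,Y)+(\beta_1+\beta_3)(r^2)\,g_u(X,u)g_u(Y,u),$$ $$G(X^h,Y^v)=\alpha_2(r^2)\,g_u(X,Y)+\beta_2(r^2)\,g_u(X,u)g_u(Y,u),$$ $$G(X^v,Y^v)=\alpha_1(r^2)\,g_u(X,Y)+\beta_1(r^2)\,g_u(X,u)g_u(Y,u).$$ Then $\zeta$ is not a conformal vector field of $(\widetilde{TM},G)$: there is no smooth function $f$ on $\widetilde{TM}$ with $\mathcal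 L_\zeta G=2fG$. In particular $\zeta$ is neither homothetic ($\mathcal L_\zeta G=2cG$ with $c$ constant) nor Killing ($\mathcal L_\zeta G=0$). -/

import Mathlib

open scoped Manifold ContDiff Bundle
open Bundle

noncomputable section

namespace FinslerGeometry

section Coordinates

variable {E : Type*} [NormedAddCommGroup E] [NormedSpace ℝ E]

/-- `g_{(y,v)}(a,b) = ½ ∂²L/∂v² (a,b)` for a function `L(y,v)` (the square of a Finsler norm in
induced coordinates `(x^i,u^i)` of a tangent bundle). -/
def coordFundamental (L : E × E → ℝ) (z : E × E) (a b : E) : ℝ :=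
  (1 / 2) * fderiv ℝ (fun z' => fderiv ℝ L z' (0, b)) z (0, a)

/-- `C_{(y,v)}(a,b,c) = ¼ ∂³L/∂v³ (a,b,c)`: the Cartan tensor in induced coordinates. -/
def coordCartan (L : E × E → ℝ) (z : E × E) (a b c : E) : ℝ :=
  (1 / 4) * fderiv ℝ (fun z'' => fderiv ℝ (fun z' => fderiv ℝ L z' (0, c)) z'' (0, b)) z (0, a)

/-- The two axioms of the Chern connection `∇` on the pullback bundle `π₀^*TM`, at the point with
induced coordinates `z = (y,v)`. For a coordinate vector `Z = (Z.1, Z.2)` tangent to `TM` and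
constant sections `a`, `b` one writes `∇_Z a = Γ Z a`; so `Γ` collects all Christoffel symbols
`Γ_{Ij}^k`, `1 ≤ I ≤ 2n`, and `ρ Z = Z.1`, `∇_Z 𝒰 = Z.2 + Γ Z v` for the canonical section `𝒰`. -/
structure IsChernSymbol (L : E × E → ℝ) (z : E × E) (Γ : E × E →ₗ[ℝ] E →ₗ[ℝ] E) : Prop where
  /-- `∇_Z ρ(W) - ∇_W ρ(Z) - ρ([Z,W]) = 0` for coordinate fields `Z`, `W`. -/
  torsion_free : ∀ Z W : E × E, Γ Z W.1 = Γ W Z.1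
  /-- `Z(g(a,b)) = g(∇_Z a, b) + g(a, ∇_Z b) + 2 C(a, b, ∇_Z 𝒰)`. -/
  almost_compatible : ∀ (Z : E × E) (a b : E),
    fderiv ℝ (fun z' => coordFundamental L z' a b) z Z =
      coordFundamental L z (Γ Z a) b + coordFundamental L z a (Γ Z b)
        + 2 * coordCartan L z a b (Z.2 + Γ Z z.2)

/-- Existence and uniqueness of the solution of the (pointwise) equations for the Christoffel
symbols of the Chern connection. -/
theorem existsUnique_symbol [FiniteDimensional ℝ E] (g : LinearMap.BilinForm ℝ E)
    (hs : ∀ a b, g a b = g b a) (hp : ∀ a, a ≠ 0 → 0 < g a a)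
    (C : E →ₗ[ℝ] E →ₗ[ℝ] E →ₗ[ℝ] ℝ) (C1 : ∀ a b c, C a b c = C b a c)
    (C2 : ∀ a b c, C a b c = C a c b) (u : E) (hu : ∀ a b, C u a b = 0)
    (D : E × E →ₗ[ℝ] E →ₗ[ℝ] E →ₗ[ℝ] ℝ) (D1 : ∀ Z a b, D Z a b = D Z b a)
    (D2 : ∀ c a b, D (0, c) a b = 2 * C c a b) :
    ∃! Γ : E × E →ₗ[ℝ] E →ₗ[ℝ] E, (∀ Z W : E × E, Γ Z W.1 = Γ W Z.1) ∧
      ∀ (Z : E × E) (a b : E), D Z a b =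
        g (Γ Z a) b + g a (Γ Z b) + 2 * C a b (Z.2 + Γ Z u) := by
  have hinj : Function.Injective g := by
    rw [← LinearMap.ker_eq_bot, LinearMap.ker_eq_bot']
    intro a ha
    by_contra h
    have := hp a h
    rw [ha] at this
    simp at this
  have hext : ∀ a b : E, (∀ w, g a w = g b w) → a = b := fun a b h => hinj (LinearMap.ext h)
  have hsurj : Function.Surjective g :=
    (LinearMap.injective_iff_surjective_of_finrank_eq_finrank
      (Subspace.dual_finrank_eq (K := ℝ) (V := E)).symm).1 hinj
  choose sh hsh using hsurj
  have hsh' : ∀ l w, g (sh l) w = l w := fun l w => by rw [hsh]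
  let D' : E →ₗ[ℝ] E →ₗ[ℝ] E →ₗ[ℝ] ℝ := D.comp (LinearMap.inl ℝ E E)
  have hD' : ∀ e a b, D (e, 0) a b = D' e a b := fun _ _ _ => rfl
  have D1' : ∀ e a b, D' e a b = D' e b a := fun _ _ _ => D1 _ _ _
  have hu2 : ∀ a b, C a u b = 0 := fun a b => by rw [C1, hu]
  have hu3 : ∀ a b, C a b u = 0 := fun a b => by rw [C2, hu2]
  let K : E → E → Module.Dual ℝ E := fun e a =>
    (1 / 2 : ℝ) • (D' e a + D' a e - (D'.flip e).flip a)
  have hK : ∀ e a b, K e a b = (1 / 2) * (D' e a b + D' a e b - D' b e a) := fun e a b => by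
    simp [K]
  let S : E := sh (K u u)
  let N : E → E := fun e => sh (K e u - C e S)
  have hN : ∀ e w, g (N e) w = K e u w - C e S w := fun e w => by simp [N, hsh']
  have hNadd : ∀ e e', N (e + e') = N e + N e' := fun e e' => hext _ _ fun w => by
    simp only [hN, hK, map_add, LinearMap.add_apply]; ring
  have hNsmul : ∀ (r : ℝ) e, N (r • e) = r • N e := fun r e => hext _ _ fun w => by
    simp only [hN, hK, map_smul, LinearMap.smul_apply, smul_eq_mul]; ring
  let Nl : E →ₗ[ℝ] E := { toFun := N, map_add' := hNadd, map_smul' := hNsmul }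
  have hNl : ∀ e, Nl e = N e := fun _ => rfl
  let T : E → E → E := fun e a => sh (K e a - C a (N e) - C e (N a) + (C e a).comp Nl)
  have hT : ∀ e a w, g (T e a) w = K e a w - C a (N e) w - C e (N a) w + C e a (N w) :=
    fun e a w => by simp [T, hsh', hNl]
  have hTs : ∀ e a, T e a = T a e := fun e a => hext _ _ fun w => by
    rw [hT, hT, C1 e a, hK, hK, D1' w e a]; ring
  have hTadd : ∀ e e' a, T (e + e') a = T e a + T e' a := fun e e' a => hext _ _ fun w => by
    simp only [hT, hK, hNadd, map_add, LinearMap.add_apply]; ring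
  have hTsmul : ∀ (r : ℝ) e a, T (r • e) a = r • T e a := fun r e a => hext _ _ fun w => by
    simp only [hT, hK, hNsmul, map_smul, LinearMap.smul_apply, smul_eq_mul]; ring
  let Tl : E →ₗ[ℝ] E →ₗ[ℝ] E := LinearMap.mk₂ ℝ T hTadd hTsmul
    (fun e a a' => by rw [hTs, hTadd, hTs a, hTs a'])
    (fun r e a => by rw [hTs, hTsmul, hTs a])
  have hNu : ∀ w, g (N u) w = g S w := fun w => by simp [hN, hu, S, hsh']
  have hNu' : N u = S := hext _ _ hNu
  have hTu : ∀ e, T e u = N e := fun e => hext _ _ fun w => by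
    rw [hT, hN, hu, hu2, hNu']; ring
  refine ⟨Tl.comp (LinearMap.fst ℝ E E), ⟨fun Z W => hTs _ _, fun Z a b => ?_⟩, ?_⟩
  · have e1 : ∀ c, (Tl.comp (LinearMap.fst ℝ E E)) Z c = T Z.1 c := fun _ => rfl
    have e2 : D Z a b = D' Z.1 a b + 2 * C Z.2 a b := by
      rw [← D2, ← hD', ← LinearMap.add_apply, ← LinearMap.add_apply, ← map_add]
      simp
    rw [e1, e1, e1, hTu, hs a, hT, hT, e2, hK, hK, map_add, D1' Z.1 b a, D1' a Z.1 b,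
      D1' b Z.1 a, C1 Z.2 a b, C2 a Z.2 b, C2 b (N Z.1) a, C1 b a,
      C2 a (N Z.1) b, C2 Z.1 (N b) a, C2 Z.1 (N a) b]
    ring
  · rintro Γ ⟨t, c⟩
    have hz : ∀ Z a, Γ Z a = Γ (Z.1, 0) a := fun Z a => by
      have h1 := t Z (a, 0)
      have h2 := t (Z.1, 0) (a, 0)
      exact h1.trans h2.symm
    have hsym : ∀ e a, Γ (e, 0) a = Γ (a, 0) e := fun e a => t (e, 0) (a, 0)
    have c' : ∀ e a b, D' e a b = g (Γ (e, 0) a) b + g a (Γ (e, 0) b)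
        + 2 * C a b (Γ (e, 0) u) := fun e a b => by
      rw [← hD', c]; simp
    have kos : ∀ e a b, g (Γ (e, 0) a) b = K e a b - C a b (Γ (e, 0) u) - C e b (Γ (a, 0) u)
        + C e a (Γ (b, 0) u) := fun e a b => by
      rw [hK, c' e a b, c' a e b, c' b e a, hsym a e, hsym b a, hsym b e, hs a, hs e]
      ring
    have k1 : Γ (u, 0) u = S := hext _ _ fun w => by
      rw [kos, hu, hu]; simp [S, hsh']
    have k2 : ∀ e, Γ (e, 0) u = N e := fun e => hext _ _ fun w => by
      rw [kos, hN, k1, hu, hu2, C2 e S]; ring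
    refine LinearMap.ext fun Z => LinearMap.ext fun a => ?_
    rw [hz]
    refine hext _ _ fun w => ?_
    change _ = g (T Z.1 a) w
    rw [kos, hT, k2, k2, k2, C2 a w, C2 Z.1 w]


/-- The axioms of the Chern connection determine its Christoffel symbols uniquely. -/
theorem existsUnique_isChernSymbol [FiniteDimensional ℝ E] {L : E × E → ℝ} {z : E × E}
    (hL : ContDiffAt ℝ ∞ L z)
    (hhom : ∀ c : ℝ, 0 < c → ∀ z' : E × E, L (z'.1, c • z'.2) = c ^ 2 * L z')
    (hpos : ∀ a, a ≠ 0 → 0 < coordFundamental L z a a) :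
    ∃! Γ : E × E →ₗ[ℝ] E →ₗ[ℝ] E, IsChernSymbol L z Γ := by
  have h1 : ContDiffAt ℝ ∞ (fderiv ℝ L) z := hL.fderiv_right (by simp)
  have h2 : ContDiffAt ℝ ∞ (fderiv ℝ (fderiv ℝ L)) z := h1.fderiv_right (by simp)
  have h2d : DifferentiableAt ℝ (fderiv ℝ (fderiv ℝ L)) z := h2.differentiableAt (by simp)
  set G2 := fderiv ℝ (fderiv ℝ L) with hG2
  have ev : ∀ᶠ z' in nhds z, ContDiffAt ℝ 2 L z' :=
    (contDiffAt_infty.1 hL 2).eventually (by simp)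
  have e2 : ∀ᶠ z' in nhds z, ∀ w w', fderiv ℝ (fun y => fderiv ℝ L y w') z' w = G2 z' w w' := by
    filter_upwards [ev] with z' hz' w w'
    have : DifferentiableAt ℝ (fderiv ℝ L) z' :=
      (hz'.fderiv_right (m := 1) (by norm_num)).differentiableAt (by simp)
    rw [fderiv_clm_apply this (differentiableAt_const _)]
    simp [hG2]
  have e2s : ∀ᶠ z' in nhds z, ∀ w w', G2 z' w w' = G2 z' w' w := by
    filter_upwards [ev] with z' hz' w w'
    exact (hz'.isSymmSndFDerivAt (by simp)) w w'
  set G3 := fderiv ℝ G2 z with hG3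
  have d3 : ∀ Z w w', fderiv ℝ (fun y => G2 y w w') z Z = G3 Z w w' := by
    intro Z w w'
    have hd : DifferentiableAt ℝ (fun y => G2 y w) z := h2d.clm_apply (differentiableAt_const _)
    rw [fderiv_clm_apply hd (differentiableAt_const _),
      fderiv_clm_apply h2d (differentiableAt_const _)]
    simp [hG3]
  have s12 : ∀ Z w, G3 Z w = G3 w Z := fun Z w =>
    ((contDiffAt_infty.1 h1 2).isSymmSndFDerivAt (by simp)) Z w
  have s23 : ∀ Z w w', G3 Z w w' = G3 Z w' w := fun Z w w' => by
    rw [← d3, ← d3]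
    have : (fun y => G2 y w w') =ᶠ[nhds z] fun y => G2 y w' w := by
      filter_upwards [e2s] with y hy using hy _ _
    rw [this.fderiv_eq]
  have gF : ∀ a b, coordFundamental L z a b = (1 / 2) * G2 z (0, a) (0, b) := fun a b => by
    rw [coordFundamental, e2.self_of_nhds]
  have gD : ∀ Z a b, fderiv ℝ (fun z' => coordFundamental L z' a b) z Z
      = (1 / 2) * G3 Z (0, a) (0, b) := fun Z a b => by
    have : (fun z' => coordFundamental L z' a b) =ᶠ[nhds z]
        fun y => (1 / 2) * G2 y (0, a) (0, b) := by
      filter_upwards [e2] with y hy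
      rw [coordFundamental, hy]
    have hd : DifferentiableAt ℝ (fun y => G2 y (0, a) (0, b)) z :=
      (h2d.clm_apply (differentiableAt_const _)).clm_apply (differentiableAt_const _)
    rw [this.fderiv_eq, fderiv_const_mul hd]
    simp [d3]
  have gC : ∀ a b c, coordCartan L z a b c = (1 / 4) * G3 (0, a) (0, b) (0, c) := fun a b c => by
    have : (fun z'' => fderiv ℝ (fun z' => fderiv ℝ L z' (0, c)) z'' (0, b)) =ᶠ[nhds z]
        fun y => G2 y (0, b) (0, c) := by
      filter_upwards [e2] with y hy using hy _ _
    rw [coordCartan, this.fderiv_eq, d3]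
  -- homogeneity
  have hom0 : ∀ c : ℝ, 0 < c → ∀ (f : E × E → ℝ) (m : ℝ),
      (∀ z' : E × E, f (z'.1, c • z'.2) = c * m * f z') →
      ∀ (z' : E × E) (b : E), fderiv ℝ f (z'.1, c • z'.2) (0, b) = m * fderiv ℝ f z' (0, b) := by
    intro c hc f m hf z' b
    let S : (E × E) ≃L[ℝ] (E × E) := (ContinuousLinearEquiv.refl ℝ E).prodCongr
      (ContinuousLinearEquiv.smulLeft (Units.mk0 c hc.ne'))
    have hS : ∀ y, S y = (y.1, c • y.2) := fun y => rfl
    have e := S.comp_right_fderiv (f := f) (x := z')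
    have e' : f ∘ S = fun y => (c * m) * f y := by
      funext y; simp [hS, hf]
    rw [e'] at e
    have e3 := congrArg (fun A : E × E →L[ℝ] ℝ => A (0, b)) e
    have e4 : fderiv ℝ (fun y => (c * m) * f y) z' = (c * m) • fderiv ℝ f z' :=
      congrFun (fderiv_const_smul_field (𝕜 := ℝ) (f := f) (c * m)) z'
    rw [e4] at e3
    have e5 : S (0, b) = c • ((0, b) : E × E) := by simp [hS]
    simp only [smul_apply, ContinuousLinearMap.comp_apply,
      ContinuousLinearEquiv.coe_coe, e5, map_smul, smul_eq_mul, hS] at e3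
    have := mul_left_cancel₀ hc.ne' ((mul_assoc c m _).symm.trans e3)
    exact this.symm
  have homC : ∀ a b, G3 (0, z.2) (0, a) (0, b) = 0 := by
    intro a b
    have hc : ∀ c : ℝ, 0 < c → coordFundamental L (z.1, c • z.2) a b = coordFundamental L z a b := by
      intro c hc
      have i1 := hom0 c hc L c (fun z' => by rw [hhom c hc]; ring)
      have i2 := hom0 c hc (fun y => fderiv ℝ L y (0, b)) 1 (fun z' => by rw [i1]; ring) z a
      rw [coordFundamental, i2, coordFundamental]; ring
    have hdiff : DifferentiableAt ℝ (fun z' => coordFundamental L z' a b) z := by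
      have : (fun z' => coordFundamental L z' a b) =ᶠ[nhds z]
          fun y => (1 / 2) * G2 y (0, a) (0, b) := by
        filter_upwards [e2] with y hy
        rw [coordFundamental, hy]
      refine DifferentiableAt.congr_of_eventuallyEq ?_ this
      exact ((h2d.clm_apply (differentiableAt_const _)).clm_apply
        (differentiableAt_const _)).const_mul _
    have hcurve : HasDerivAt (fun c : ℝ => ((z.1, c • z.2) : E × E)) (0, z.2) 1 := by
      have := (hasDerivAt_id (1 : ℝ)).smul_const z.2
      simpa using (hasDerivAt_const (1 : ℝ) z.1).prodMk this
    have hz1 : ((z.1, (1 : ℝ) • z.2) : E × E) = z := by simp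
    have hcomp : HasDerivAt (fun c : ℝ => coordFundamental L (z.1, c • z.2) a b)
        (fderiv ℝ (fun z' => coordFundamental L z' a b) z (0, z.2)) 1 := by
      have hf := hdiff.hasFDerivAt
      rw [← hz1] at hf
      have := hf.comp_hasDerivAt (1 : ℝ) hcurve
      rw [hz1] at this
      exact this
    have hconst : HasDerivAt (fun c : ℝ => coordFundamental L (z.1, c • z.2) a b) 0 1 := by
      refine (hasDerivAt_const (1 : ℝ) (coordFundamental L z a b)).congr_of_eventuallyEq ?_
      filter_upwards [lt_mem_nhds (zero_lt_one' ℝ)] with c hc' using hc c hc'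
    have := hcomp.unique hconst
    rw [gD] at this
    linarith
  -- the linear algebra
  let i := LinearMap.inr ℝ E E
  have hi : ∀ a, i a = (0, a) := fun _ => rfl
  let gl : LinearMap.BilinForm ℝ E := LinearMap.mk₂ ℝ (fun a b => (1 / 2) * G2 z (i a) (i b))
    (fun a a' b => by simp only [map_add, add_apply]; ring)
    (fun r a b => by simp only [map_smul, smul_apply, smul_eq_mul]; ring)
    (fun a b b' => by simp only [map_add]; ring)
    (fun r a b => by simp only [map_smul, smul_eq_mul]; ring)
  let Dl : E × E →ₗ[ℝ] E →ₗ[ℝ] E →ₗ[ℝ] ℝ :=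
    { toFun := fun Z => LinearMap.mk₂ ℝ (fun a b => (1 / 2) * G3 Z (i a) (i b))
        (fun a a' b => by simp only [map_add, add_apply]; ring)
        (fun r a b => by simp only [map_smul, smul_apply, smul_eq_mul]; ring)
        (fun a b b' => by simp only [map_add]; ring)
        (fun r a b => by simp only [map_smul, smul_eq_mul]; ring)
      map_add' := fun Z Z' => by
        have h : G3 (Z + Z') = G3 Z + G3 Z' := G3.map_add Z Z'
        ext a b
        simp only [LinearMap.mk₂_apply, LinearMap.add_apply, h, add_apply]; ring
      map_smul' := fun r Z => by
        have h : G3 (r • Z) = r • G3 Z := G3.map_smul r Z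
        ext a b
        simp only [LinearMap.mk₂_apply, LinearMap.smul_apply, h, smul_apply, smul_eq_mul,
          RingHom.id_apply]; ring }
  let Cl : E →ₗ[ℝ] E →ₗ[ℝ] E →ₗ[ℝ] ℝ := (1 / 2 : ℝ) • Dl.comp i
  have hgl : ∀ a b, gl a b = coordFundamental L z a b := fun a b => (gF a b).symm
  have hDl : ∀ Z a b, Dl Z a b = fderiv ℝ (fun z' => coordFundamental L z' a b) z Z :=
    fun Z a b => (gD Z a b).symm
  have hDl' : ∀ Z a b, Dl Z a b = (1 / 2) * G3 Z (0, a) (0, b) := fun Z a b => rfl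
  have hCl' : ∀ a b c, Cl a b c = (1 / 4) * G3 (0, a) (0, b) (0, c) := fun a b c => by
    have : Cl a b c = (1 / 2) * Dl (0, a) b c := rfl
    rw [this, hDl']; ring
  have hCl : ∀ a b c, Cl a b c = coordCartan L z a b c := fun a b c => by rw [hCl', gC]
  have key := existsUnique_symbol gl
    (fun a b => by rw [hgl, hgl, gF, gF, e2s.self_of_nhds])
    (fun a ha => by rw [hgl]; exact hpos a ha) Cl
    (fun a b c => by rw [hCl', hCl', s12]) (fun a b c => by rw [hCl', hCl', s23]) z.2
    (fun a b => by rw [hCl', homC]; ring) Dl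
    (fun Z a b => by rw [hDl', hDl', s23])
    (fun c a b => by rw [hDl', hCl']; ring)
  have heq : ∀ Γ : E × E →ₗ[ℝ] E →ₗ[ℝ] E, IsChernSymbol L z Γ ↔
      ((∀ Z W : E × E, Γ Z W.1 = Γ W Z.1) ∧ ∀ (Z : E × E) (a b : E), Dl Z a b =
        gl (Γ Z a) b + gl a (Γ Z b) + 2 * Cl a b (Z.2 + Γ Z z.2)) := fun Γ => by
    simp only [hDl, hgl, hCl]
    exact ⟨fun h => ⟨h.1, h.2⟩, fun h => ⟨h.1, h.2⟩⟩
  simpa only [heq] using key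

/-- In coordinates, `½ ∂²/∂t∂s` at `t = s = 0` is `coordFundamental`. -/
theorem coordFundamental_eq_deriv {L : E × E → ℝ} {z : E × E} (hL : ContDiffAt ℝ ∞ L z)
    (a b : E) : coordFundamental L z a b =
      (1 / 2) * deriv (fun t : ℝ => deriv (fun s : ℝ => L (z.1, z.2 + t • a + s • b)) 0) 0 := by
  have h1 : DifferentiableAt ℝ (fderiv ℝ L) z :=
    (hL.fderiv_right (m := 1) (by norm_cast)).differentiableAt (by simp)
  have ev : ∀ᶠ z' in nhds z, ContDiffAt ℝ 2 L z' :=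
    (contDiffAt_infty.1 hL 2).eventually (by simp)
  have line : ∀ (w : E × E) (c : E), HasDerivAt (fun s : ℝ => ((w.1, w.2 + s • c) : E × E))
      (0, c) 0 := fun w c => by
    have := ((hasDerivAt_id (0 : ℝ)).smul_const c).const_add w.2
    simpa using (hasDerivAt_const (0 : ℝ) w.1).prodMk this
  have hin : (fun t : ℝ => deriv (fun s : ℝ => L (z.1, z.2 + t • a + s • b)) 0) =ᶠ[nhds 0]
      fun t => fderiv ℝ L (z.1, z.2 + t • a) (0, b) := by
    have hc : Filter.Tendsto (fun t : ℝ => ((z.1, z.2 + t • a) : E × E)) (nhds 0) (nhds z) := by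
      simpa using (line z a).continuousAt.tendsto
    filter_upwards [hc.eventually ev] with t ht
    have hd : HasFDerivAt L (fderiv ℝ L (z.1, z.2 + t • a))
        (((z.1, z.2 + t • a) : E × E).1, ((z.1, z.2 + t • a) : E × E).2 + (0 : ℝ) • b) := by
      simpa using (ht.differentiableAt (by simp)).hasFDerivAt
    exact (hd.comp_hasDerivAt (0 : ℝ) (line (z.1, z.2 + t • a) b)).deriv
  have hd : HasFDerivAt (fun z' => fderiv ℝ L z' (0, b))
      (fderiv ℝ (fun z' => fderiv ℝ L z' (0, b)) z) (z.1, z.2 + (0 : ℝ) • a) := by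
    simpa using (h1.clm_apply (differentiableAt_const _)).hasFDerivAt
  rw [hin.deriv_eq, coordFundamental]
  exact congrArg _ (hd.comp_hasDerivAt (0 : ℝ) (line z a)).deriv.symm

end Coordinates

variable (E : Type*) [NormedAddCommGroup E] [NormedSpace ℝ E]
  (M : Type*) [TopologicalSpace M] [ChartedSpace E M] [IsManifold 𝓘(ℝ, E) ∞ M]

/-- The slit tangent bundle of `M`, as an (open) subset of the tangent bundle. -/
def slit : Set (TangentBundle 𝓘(ℝ, E) M) := {p | p.2 ≠ 0}

variable {E M}

/-- `g_u(v,w) = ½ ∂²/∂t∂s F²(u + t v + s w)` at `t = s = 0`, for the point `p = (x,u)` of `TM`. -/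
def fundamentalTensor (F : TangentBundle 𝓘(ℝ, E) M → ℝ) (p : TangentBundle 𝓘(ℝ, E) M)
    (v w : TangentSpace 𝓘(ℝ, E) p.proj) : ℝ :=
  (1 / 2) * deriv (fun t : ℝ => deriv (fun s : ℝ =>
    F ⟨p.proj, p.2 + t • v + s • w⟩ ^ 2) 0) 0

variable (E M) in
/-- A Finsler norm on `M`. -/
structure FinslerNorm where
  /-- the norm `F : TM → [0, ∞)` -/
  toFun : TangentBundle 𝓘(ℝ, E) M → ℝ
  nonneg : ∀ p, 0 ≤ toFun p
  smooth : ContMDiffOn 𝓘(ℝ, E).tangent 𝓘(ℝ, ℝ) ∞ toFun (slit E M)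
  homogeneous : ∀ (p : TangentBundle 𝓘(ℝ, E) M) (c : ℝ), 0 < c →
    toFun ⟨p.proj, c • p.2⟩ = c * toFun p
  posDef : ∀ p ∈ slit E M, ∀ v : TangentSpace 𝓘(ℝ, E) p.proj, v ≠ 0 →
    0 < fundamentalTensor toFun p v v

/-- The coordinates `(x^i, u^i)` of the point `p` of `TM`, induced by the preferred chart of `M` at
the base point of `p`. -/
def coord (p : TangentBundle 𝓘(ℝ, E) M) : E × E := extChartAt 𝓘(ℝ, E).tangent p p

theorem coord_eq (p : TangentBundle 𝓘(ℝ, E) M) :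
    coord p = (extChartAt 𝓘(ℝ, E) p.proj p.proj, p.2) := by
  refine Prod.ext rfl ?_
  exact tangentCoordChange_self (I := 𝓘(ℝ, E)) (mem_extChartAt_source p.proj)

theorem slit_mem_nhds {p : TangentBundle 𝓘(ℝ, E) M} (hp : p ∈ slit E M) :
    slit E M ∈ nhds p := by
  have hc : ContinuousAt (fun q => (extChartAt 𝓘(ℝ, E).tangent p q).2) p :=
    continuous_snd.continuousAt.comp (continuousAt_extChartAt p)
  have h0 : (extChartAt 𝓘(ℝ, E).tangent p p).2 ≠ 0 := by
    have := congrArg Prod.snd (coord_eq p)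
    rw [coord] at this
    rw [this]; exact hp
  filter_upwards [hc.eventually_ne h0] with q hq h
  refine hq ?_
  have e : (extChartAt 𝓘(ℝ, E).tangent p q).2 =
    (tangentBundleCore 𝓘(ℝ, E) M).coordChange (achart E q.proj) (achart E p.proj) q.proj q.2 := rfl
  rw [e, h]
  exact map_zero _

namespace FinslerNorm

/-- The fundamental tensor `g` of a Finsler norm. -/
def g (F : FinslerNorm E M) (p : TangentBundle 𝓘(ℝ, E) M)
    (v w : TangentSpace 𝓘(ℝ, E) p.proj) : ℝ := fundamentalTensor F.toFun p v w

/-- The function `F²` in the coordinates `(x^i, u^i)` on `TM` induced by the preferred chart of `M`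
at the base point of `p`. -/
def coordSq (F : FinslerNorm E M) (p : TangentBundle 𝓘(ℝ, E) M) (z : E × E) : ℝ :=
  F.toFun ((extChartAt 𝓘(ℝ, E).tangent p).symm z) ^ 2

theorem contDiffAt_coordSq (F : FinslerNorm E M) {p : TangentBundle 𝓘(ℝ, E) M}
    (hp : p ∈ slit E M) : ContDiffAt ℝ ∞ (F.coordSq p) (coord p) := by
  have h := ((F.smooth p hp).contMDiffAt (slit_mem_nhds hp))
  rw [contMDiffAt_iff] at h
  have h2 := h.2
  have hr : Set.range 𝓘(ℝ, E).tangent = Set.univ := ModelWithCorners.range_eq_univ _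
  rw [hr, contDiffWithinAt_univ] at h2
  exact h2.pow 2

theorem coordSq_smul (F : FinslerNorm E M) (p : TangentBundle 𝓘(ℝ, E) M) (c : ℝ) (hc : 0 < c)
    (z : E × E) : F.coordSq p (z.1, c • z.2) = c ^ 2 * F.coordSq p z := by
  have e : (extChartAt 𝓘(ℝ, E).tangent p).symm (z.1, c • z.2) =
      ⟨((extChartAt 𝓘(ℝ, E).tangent p).symm z).proj,
        c • ((extChartAt 𝓘(ℝ, E).tangent p).symm z).2⟩ := by
    refine congrArg (TotalSpace.mk ((extChartAt 𝓘(ℝ, E) p.proj).symm z.1)) ?_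
    exact map_smul ((tangentBundleCore 𝓘(ℝ, E) M).coordChange (achart E p.proj)
      (achart E ((extChartAt 𝓘(ℝ, E) p.proj).symm z.1)) ((extChartAt 𝓘(ℝ, E) p.proj).symm z.1)) c z.2
  rw [coordSq, e, F.homogeneous _ c hc, coordSq]
  ring

theorem coordSq_fiber (F : FinslerNorm E M) (p : TangentBundle 𝓘(ℝ, E) M) (v : E) :
    F.coordSq p ((coord p).1, v) = F.toFun ⟨p.proj, v⟩ ^ 2 := by
  have e : coord (⟨p.proj, v⟩ : TangentBundle 𝓘(ℝ, E) M) = ((coord p).1, v) := coord_eq _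
  have e' : (extChartAt 𝓘(ℝ, E).tangent p).symm ((coord p).1, v) = ⟨p.proj, v⟩ := by
    have h := extChartAt_to_inv (I := 𝓘(ℝ, E).tangent) (⟨p.proj, v⟩ : TangentBundle 𝓘(ℝ, E) M)
    exact (congrArg (extChartAt 𝓘(ℝ, E).tangent p).symm e.symm).trans h
  rw [coordSq, e']

/-- The fundamental tensor is the one computed in induced coordinates. -/
theorem g_eq_coordFundamental (F : FinslerNorm E M) {p : TangentBundle 𝓘(ℝ, E) M}
    (hp : p ∈ slit E M) (a b : E) :
    F.g p a b = coordFundamental (F.coordSq p) (coord p) a b := by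
  rw [coordFundamental_eq_deriv (F.contDiffAt_coordSq hp)]
  refine congrArg (fun f : ℝ → ℝ => (1 / 2) * deriv f 0) (funext fun t => ?_)
  refine congrArg (fun f : ℝ → ℝ => deriv f 0) (funext fun s => ?_)
  have e : (coord p).2 = p.2 := congrArg Prod.snd (coord_eq p)
  rw [e]
  exact (F.coordSq_fiber p _).symm

theorem existsUnique_chernSymbol [FiniteDimensional ℝ E] (F : FinslerNorm E M)
    {p : TangentBundle 𝓘(ℝ, E) M} (hp : p ∈ slit E M) :
    ∃! Γ : E × E →ₗ[ℝ] E →ₗ[ℝ] E, IsChernSymbol (F.coordSq p) (coord p) Γ :=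
  existsUnique_isChernSymbol (F.contDiffAt_coordSq hp) (F.coordSq_smul p) fun a ha => by
    exact (F.posDef p hp a ha).trans_eq (F.g_eq_coordFundamental hp a a)

open Classical in
/-- The Christoffel symbols at `p = (x,u)`, `u ≠ 0`, of the Chern connection, the unique connection
on `π₀^*TM` that is torsion free and almost compatible with `g`, in the coordinates induced by the
preferred chart of `M` at `x` (and `0` at the points of the zero section). -/
def chernSymbol [FiniteDimensional ℝ E] (F : FinslerNorm E M) (p : TangentBundle 𝓘(ℝ, E) M) :
    E × E →ₗ[ℝ] E →ₗ[ℝ] E :=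
  if hp : p ∈ slit E M then (F.existsUnique_chernSymbol hp).choose else 0

/-- The horizontal lift `X^h = X^i ∂/∂x^i - Γ_{kj}^i X^j u^k ∂/∂u^i` of `X ∈ T_x M` at `p = (x,u)`,
i.e. the vector over `X` along which the canonical section is parallel. Tangent vectors of `TM` at
`p` are identified, as everywhere in Mathlib, with their components in the coordinates induced by
the preferred chart. -/
def horizontalLift [FiniteDimensional ℝ E] (F : FinslerNorm E M) (p : TangentBundle 𝓘(ℝ, E) M)
    (X : TangentSpace 𝓘(ℝ, E) p.proj) : TangentSpace 𝓘(ℝ, E).tangent p :=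
  ((X, -(F.chernSymbol p (X, 0) p.2)) : E × E)

/-- The geodesic vector field `ζ = u^i δ/δx^i`: its value at `(x,u)` is the horizontal lift of `u`. -/
def geodesicField [FiniteDimensional ℝ E] (F : FinslerNorm E M) (p : TangentBundle 𝓘(ℝ, E) M) :
    TangentSpace 𝓘(ℝ, E).tangent p :=
  F.horizontalLift p p.2

end FinslerNorm

/-- The vertical lift `X^v = X^i ∂/∂u^i = d/dt|_{t=0} (u + tX)` of `X ∈ T_x M` at `p = (x,u)`. -/
def verticalLift (p : TangentBundle 𝓘(ℝ, E) M) (X : TangentSpace 𝓘(ℝ, E) p.proj) :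
    TangentSpace 𝓘(ℝ, E).tangent p :=
  ((0, X) : E × E)

/-- `G` is a (smooth) pseudo-Riemannian metric on the slit tangent bundle; its values on the zero
section are irrelevant. -/
structure IsPseudoRiemannianMetric
    (G : ∀ p : TangentBundle 𝓘(ℝ, E) M, TangentSpace 𝓘(ℝ, E).tangent p →L[ℝ]
      TangentSpace 𝓘(ℝ, E).tangent p →L[ℝ] ℝ) : Prop where
  smooth : ContMDiffOn 𝓘(ℝ, E).tangent (𝓘(ℝ, E).tangent.prod 𝓘(ℝ, E × E →L[ℝ] E × E →L[ℝ] ℝ)) ∞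
    (fun p => TotalSpace.mk' (E × E →L[ℝ] E × E →L[ℝ] ℝ)
      (E := fun p : TangentBundle 𝓘(ℝ, E) M => TangentSpace 𝓘(ℝ, E).tangent p →L[ℝ]
        TangentSpace 𝓘(ℝ, E).tangent p →L[ℝ] ℝ) p (G p)) (slit E M)
  symm : ∀ p ∈ slit E M, ∀ v w, G p v w = G p w v
  nondegenerate : ∀ p ∈ slit E M, ∀ v, (∀ w, G p v w = 0) → v = 0

/-- `G` is an `F`-natural metric: it is built from `g`, the canonical section `𝒰` (`𝒰 = u` at
`(x,u)`) and six real functions of `r² = F²` (only the values on `(0, ∞)` matter). -/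
def IsFNatural [FiniteDimensional ℝ E] (F : FinslerNorm E M)
    (G : ∀ p : TangentBundle 𝓘(ℝ, E) M, TangentSpace 𝓘(ℝ, E).tangent p →L[ℝ]
      TangentSpace 𝓘(ℝ, E).tangent p →L[ℝ] ℝ) : Prop :=
  ∃ α₁ α₂ α₃ β₁ β₂ β₃ : ℝ → ℝ, ∀ p ∈ slit E M, ∀ X Y : TangentSpace 𝓘(ℝ, E) p.proj,
    G p (F.horizontalLift p X) (F.horizontalLift p Y) =
        (α₁ (F.toFun p ^ 2) + α₃ (F.toFun p ^ 2)) * F.g p X Y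
          + (β₁ (F.toFun p ^ 2) + β₃ (F.toFun p ^ 2)) * (F.g p X p.2 * F.g p Y p.2) ∧
    G p (F.horizontalLift p X) (verticalLift p Y) =
        α₂ (F.toFun p ^ 2) * F.g p X Y + β₂ (F.toFun p ^ 2) * (F.g p X p.2 * F.g p Y p.2) ∧
    G p (verticalLift p X) (verticalLift p Y) =
        α₁ (F.toFun p ^ 2) * F.g p X Y + β₁ (F.toFun p ^ 2) * (F.g p X p.2 * F.g p Y p.2)

/-- Smooth vector fields on the slit tangent bundle. -/
def IsSmoothField (X : ∀ p : TangentBundle 𝓘(ℝ, E) M, TangentSpace 𝓘(ℝ, E).tangent p) : Prop :=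
  ContMDiffOn 𝓘(ℝ, E).tangent 𝓘(ℝ, E).tangent.tangent ∞
    (fun p => (⟨p, X p⟩ : TangentBundle 𝓘(ℝ, E).tangent (TangentBundle 𝓘(ℝ, E) M))) (slit E M)

/-- The derivative `v(f)` of a function `f` on `TM` in the direction of a tangent vector `v`. -/
def dirDeriv (f : TangentBundle 𝓘(ℝ, E) M → ℝ) (p : TangentBundle 𝓘(ℝ, E) M)
    (v : TangentSpace 𝓘(ℝ, E).tangent p) : ℝ :=
  mfderiv 𝓘(ℝ, E).tangent 𝓘(ℝ, ℝ) f p v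

/-- The Lie derivative `(ℒ_ξ G)(X,Y) = ξ(G(X,Y)) - G([ξ,X],Y) - G(X,[ξ,Y])`. -/
def lieDerivative
    (G : ∀ p : TangentBundle 𝓘(ℝ, E) M, TangentSpace 𝓘(ℝ, E).tangent p →L[ℝ]
      TangentSpace 𝓘(ℝ, E).tangent p →L[ℝ] ℝ)
    (ξ X Y : ∀ p : TangentBundle 𝓘(ℝ, E) M, TangentSpace 𝓘(ℝ, E).tangent p)
    (p : TangentBundle 𝓘(ℝ, E) M) : ℝ :=
  dirDeriv (fun q => G q (X q) (Y q)) p (ξ p)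
    - G p (VectorField.mlieBracket 𝓘(ℝ, E).tangent ξ X p) (Y p)
    - G p (X p) (VectorField.mlieBracket 𝓘(ℝ, E).tangent ξ Y p)

/-- `ℒ_ξ G = 2 f G` on the slit tangent bundle. -/
def HasPotential
    (G : ∀ p : TangentBundle 𝓘(ℝ, E) M, TangentSpace 𝓘(ℝ, E).tangent p →L[ℝ]
      TangentSpace 𝓘(ℝ, E).tangent p →L[ℝ] ℝ)
    (ξ : ∀ p : TangentBundle 𝓘(ℝ, E) M, TangentSpace 𝓘(ℝ, E).tangent p)
    (f : TangentBundle 𝓘(ℝ, E) M → ℝ) : Prop :=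
  ∀ X Y : ∀ p : TangentBundle 𝓘(ℝ, E) M, TangentSpace 𝓘(ℝ, E).tangent p,
    IsSmoothField X → IsSmoothField Y → ∀ p ∈ slit E M,
      lieDerivative G ξ X Y p = 2 * f p * G p (X p) (Y p)

/-- The vector field `ξ` on the slit tangent bundle is conformal for `G`. -/
def IsConformal
    (G : ∀ p : TangentBundle 𝓘(ℝ, E) M, TangentSpace 𝓘(ℝ, E).tangent p →L[ℝ]
      TangentSpace 𝓘(ℝ, E).tangent p →L[ℝ] ℝ)
    (ξ : ∀ p : TangentBundle 𝓘(ℝ, E) M, TangentSpace 𝓘(ℝ, E).tangent p) : Prop :=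
  ∃ f : TangentBundle 𝓘(ℝ, E) M → ℝ,
    ContMDiffOn 𝓘(ℝ, E).tangent 𝓘(ℝ, ℝ) ∞ f (slit E M) ∧ HasPotential G ξ f

/-- The vector field `ξ` is homothetic for `G`: conformal with constant potential. -/
def IsHomothetic
    (G : ∀ p : TangentBundle 𝓘(ℝ, E) M, TangentSpace 𝓘(ℝ, E).tangent p →L[ℝ]
      TangentSpace 𝓘(ℝ, E).tangent p →L[ℝ] ℝ)
    (ξ : ∀ p : TangentBundle 𝓘(ℝ, E) M, TangentSpace 𝓘(ℝ, E).tangent p) : Prop :=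
  ∃ c : ℝ, HasPotential G ξ (fun _ => c)

/-- The vector field `ξ` is Killing for `G`: conformal with potential `0`. -/
def IsKilling
    (G : ∀ p : TangentBundle 𝓘(ℝ, E) M, TangentSpace 𝓘(ℝ, E).tangent p →L[ℝ]
      TangentSpace 𝓘(ℝ, E).tangent p →L[ℝ] ℝ)
    (ξ : ∀ p : TangentBundle 𝓘(ℝ, E) M, TangentSpace 𝓘(ℝ, E).tangent p) : Prop :=
  HasPotential G ξ (fun _ => 0)

end FinslerGeometry

end

open FinslerGeometry

/-! Write `𝓛` for the Liouville field, whose value at `u` is `u^v`, and `ζ` for the geodesic field.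
Two facts drive the argument: `[ζ, 𝓛] = -ζ`, since `ζ` is a spray, and `ζ` kills every function of
`F²`, since `F` is constant along horizontal vectors. By `F`-naturality and `g_u(u,u) = F²`, the
functions `A = G(𝓛,𝓛)`, `B = G(ζ,𝓛)` and `C = G(ζ,ζ)` depend on `F²` only. Testing `ℒ_ζ G = 2fG` on
`(𝓛,𝓛)`, `(𝓛,ζ)` and `(ζ,ζ)` therefore gives `B = fA`, `C = 2fB` and `0 = fC`. Whether or not `f`
vanishes at a given point, `B = C = 0` there. But `G(ζ, X^h)` and `G(ζ, X^v)` are multiples of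
`g_u(u,X)` whose coefficients are `C/F²` and `B/F²`. So `ζ` is orthogonal to everything, against
nondegeneracy and `u ≠ 0`.

The work lies in the two facts about `ζ`, and in its smoothness, because the Christoffel symbols are
given point by point, each in its own preferred chart. The remedy is to characterise `ζ` by the
Euler–Lagrange equation of `L = F²`: it follows from the axioms of the Chern connection
(`IsChernSymbol.isSprayAt`), is invariant under changes of chart (`IsSprayAt.comp`), has a unique
solution because the fibre Hessian is invertible (`IsSprayAt.eq_sprayCoeff`), and scales correctly
in the fibre (`IsSprayAt.smul`). Thus near each point `ζ` is `(v, sprayCoeff L)` in a single chart,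
smooth and fibrewise homogeneous of degree two in its second component, and the bracket is Euler's
identity. -/

noncomputable section

namespace FinslerGeometry

/-! ### Derivatives of the energy in coordinates. -/

section Spray

variable {E : Type*} [NormedAddCommGroup E] [NormedSpace ℝ E]

/-- The Euler–Lagrange equation of the energy `L`: the vector `W` at `z = (y,v)` satisfies
`W(∂L/∂v^b) = ∂L/∂y^b`. -/
def IsSprayAt (L : E × E → ℝ) (z W : E × E) : Prop :=
  ∀ b : E, fderiv ℝ (fun z' => fderiv ℝ L z' (0, b)) z W = fderiv ℝ L z (b, 0)

theorem fderiv_fderiv_apply {V : Type*} [NormedAddCommGroup V] [NormedSpace ℝ V] {L : V → ℝ}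
    {z : V} (hL : ContDiffAt ℝ 2 L z) (X Y : V) :
    fderiv ℝ (fun z' => fderiv ℝ L z' Y) z X = fderiv ℝ (fderiv ℝ L) z X Y := by
  have : DifferentiableAt ℝ (fderiv ℝ L) z :=
    (hL.fderiv_right (m := 1) (by norm_num)).differentiableAt (by simp)
  rw [fderiv_clm_apply this (differentiableAt_const _)]
  simp

theorem coordFundamental_eq {L : E × E → ℝ} {z : E × E} (hL : ContDiffAt ℝ 2 L z) (a b : E) :
    coordFundamental L z a b = (1 / 2) * fderiv ℝ (fderiv ℝ L) z (0, a) (0, b) := by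
  rw [coordFundamental, fderiv_fderiv_apply hL]

theorem fderiv_coordFundamental {L : E × E → ℝ} {z : E × E} (hL : ContDiffAt ℝ ∞ L z) (a b : E)
    (Z : E × E) : fderiv ℝ (fun z' => coordFundamental L z' a b) z Z =
      (1 / 2) * fderiv ℝ (fderiv ℝ (fderiv ℝ L)) z Z (0, a) (0, b) := by
  have h2d : DifferentiableAt ℝ (fderiv ℝ (fderiv ℝ L)) z :=
    ((hL.fderiv_right (m := ∞) (by simp)).fderiv_right (m := ∞) (by simp)).differentiableAt
      (by simp)
  have ev : ∀ᶠ z' in nhds z, ContDiffAt ℝ 2 L z' :=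
    (contDiffAt_infty.1 hL 2).eventually (by simp)
  have e : (fun z' => coordFundamental L z' a b) =ᶠ[nhds z]
      fun y => (1 / 2) * fderiv ℝ (fderiv ℝ L) y (0, a) (0, b) := by
    filter_upwards [ev] with y hy using coordFundamental_eq hy a b
  have hd1 : DifferentiableAt ℝ (fun y => fderiv ℝ (fderiv ℝ L) y (0, a)) z :=
    h2d.clm_apply (differentiableAt_const _)
  rw [e.fderiv_eq, fderiv_const_mul (hd1.clm_apply (differentiableAt_const _)),
    smul_apply, fderiv_clm_apply hd1 (differentiableAt_const _),
    fderiv_clm_apply h2d (differentiableAt_const _)]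
  simp

theorem coordCartan_zero_right (L : E × E → ℝ) (z : E × E) (a b : E) :
    coordCartan L z a b 0 = 0 := by
  have h : ∀ z', fderiv ℝ L z' ((0, 0) : E × E) = 0 := fun z' => map_zero _
  simp [coordCartan, h]

/-! ### Fibre homogeneity and Euler's identity. -/

/-- Fibrewise scaling by `c`. -/
def fiberScale (c : ℝ) (hc : c ≠ 0) : (E × E) ≃L[ℝ] (E × E) :=
  (ContinuousLinearEquiv.refl ℝ E).prodCongr (ContinuousLinearEquiv.smulLeft (Units.mk0 c hc))

theorem fiberScale_apply (c : ℝ) (hc : c ≠ 0) (z : E × E) :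
    fiberScale c hc z = (z.1, c • z.2) := rfl

/-- Fibrewise positive homogeneity of degree two. -/
def IsHomogeneousTwo (L : E × E → ℝ) : Prop :=
  ∀ c : ℝ, 0 < c → ∀ z : E × E, L (z.1, c • z.2) = c ^ 2 * L z

/-- Scaling is a linear isomorphism, so the chain rule needs no differentiability of `f`. This is
how homogeneity passes from `L` to its derivatives at every point. -/
theorem fderiv_comp_fiberScale {f : E × E → ℝ} {h : E × E → ℝ} {c k : ℝ} (hc : c ≠ 0)
    (hf : ∀ z, f (fiberScale c hc z) = k * h z) (z Y : E × E) :
    fderiv ℝ f (fiberScale c hc z) (fiberScale c hc Y) = k * fderiv ℝ h z Y := by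
  have e := (fiberScale c hc : (E × E) ≃L[ℝ] (E × E)).comp_right_fderiv (f := f) (x := z)
  have e' : f ∘ fiberScale c hc = fun y => k * h y := funext hf
  have e4 : fderiv ℝ (fun y => k * h y) z = k • fderiv ℝ h z :=
    congrFun (fderiv_const_smul_field (𝕜 := ℝ) (f := h) k) z
  rw [e', e4] at e
  exact (congrArg (fun A : E × E →L[ℝ] ℝ => A Y) e).symm

/-- Sprays are fibrewise homogeneous of degree two. -/
theorem IsSprayAt.smul {L : E × E → ℝ} (hhom : IsHomogeneousTwo L) {z W : E × E}
    (h : IsSprayAt L z W) {c : ℝ} (hc : 0 < c) :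
    IsSprayAt L (z.1, c • z.2) (c • W.1, c ^ 2 • W.2) := by
  intro b
  have h1 := fderiv_comp_fiberScale (f := L) (h := L) hc.ne' (hhom c hc)
  have h2 : ∀ z, (fun z' => fderiv ℝ L z' (0, b)) (fiberScale c hc.ne' z) =
      c * (fun z' => fderiv ℝ L z' (0, b)) z := by
    intro z
    -- The vector is shrunk beforehand so that scaling carries it to `(0, b)`; fibre derivatives of
    -- `L` then have degree one.
    have e := h1 z (0, c⁻¹ • b)
    have e1 : fiberScale c hc.ne' ((0, c⁻¹ • b) : E × E) = (0, b) := by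
      simp [fiberScale_apply, smul_smul, hc.ne']
    have e2 : ((0, c⁻¹ • b) : E × E) = c⁻¹ • (0, b) := by simp
    rw [e1, e2, map_smul, smul_eq_mul] at e
    simp only [e]
    field_simp
  -- The scaled spray vector is the image of `c • W` under fibre scaling: one factor `c` on the base
  -- part, two on the fibre part.
  have h3 := fderiv_comp_fiberScale (f := fun z' => fderiv ℝ L z' (0, b))
    (h := fun z' => fderiv ℝ L z' (0, b)) hc.ne' h2 z (c • W)
  have e3 : fiberScale c hc.ne' (c • W) = (c • W.1, c ^ 2 • W.2) := by
    simp [fiberScale_apply, smul_smul, pow_two]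
  have h4 := h1 z (b, 0)
  have e4 : fiberScale c hc.ne' ((b, 0) : E × E) = (b, 0) := by simp [fiberScale_apply]
  rw [e3, map_smul, h b, smul_eq_mul] at h3
  rw [e4] at h4
  rw [fiberScale_apply] at h3 h4
  rw [h3, h4]
  ring

theorem hasDerivAt_fiber_smul (z : E × E) :
    HasDerivAt (fun c : ℝ => ((z.1, c • z.2) : E × E)) (0, z.2) 1 := by
  have := (hasDerivAt_id (1 : ℝ)).smul_const z.2
  simpa using (hasDerivAt_const (1 : ℝ) z.1).prodMk this

/-- Euler's identity. -/
theorem fderiv_fiber_of_homogeneous {V : Type*} [NormedAddCommGroup V] [NormedSpace ℝ V]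
    {f : E × E → V} {z : E × E} {m : ℕ} (hf : DifferentiableAt ℝ f z)
    (hhom : ∀ᶠ c in nhds (1 : ℝ), f (z.1, c • z.2) = c ^ m • f z) :
    fderiv ℝ f z (0, z.2) = (m : ℝ) • f z := by
  have hf' : HasFDerivAt f (fderiv ℝ f z) ((z.1, (1 : ℝ) • z.2) : E × E) := by
    simpa using hf.hasFDerivAt
  have h1 := hf'.comp_hasDerivAt (1 : ℝ) (hasDerivAt_fiber_smul z)
  have h2 : HasDerivAt (fun c : ℝ => c ^ m • f z) ((m : ℝ) • f z) 1 := by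
    simpa using (hasDerivAt_pow m (1 : ℝ)).smul_const (f z)
  exact h1.unique (h2.congr_of_eventuallyEq hhom)

theorem IsHomogeneousTwo.fderiv_self {L : E × E → ℝ} (hhom : IsHomogeneousTwo L) {z : E × E}
    (hL : DifferentiableAt ℝ L z) : fderiv ℝ L z (0, z.2) = 2 * L z := by
  have := fderiv_fiber_of_homogeneous (m := 2) hL (by
    filter_upwards [lt_mem_nhds (zero_lt_one' ℝ)] with c hc using hhom c hc z)
  simpa using this

theorem IsHomogeneousTwo.fderiv_fderiv_self {L : E × E → ℝ} (hhom : IsHomogeneousTwo L)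
    {z : E × E} (hL : ContDiffAt ℝ 2 L z) (b : E) :
    fderiv ℝ (fderiv ℝ L) z (0, z.2) (0, b) = fderiv ℝ L z (0, b) := by
  have hd : DifferentiableAt ℝ (fun z' => fderiv ℝ L z' ((0, b) : E × E)) z :=
    ((hL.fderiv_right (m := 1) (by norm_num)).differentiableAt (by simp)).clm_apply
      (differentiableAt_const _)
  have := fderiv_fiber_of_homogeneous (m := 1) hd (by
    filter_upwards [lt_mem_nhds (zero_lt_one' ℝ)] with c hc
    have e := fderiv_comp_fiberScale (f := L) (h := L) hc.ne' (hhom c hc) z (0, c⁻¹ • b)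
    have e1 : fiberScale c hc.ne' ((0, c⁻¹ • b) : E × E) = (0, b) := by
      simp [fiberScale_apply, smul_smul, hc.ne']
    have e2 : ((0, c⁻¹ • b) : E × E) = c⁻¹ • (0, b) := by simp
    rw [e1, e2, map_smul, smul_eq_mul, fiberScale_apply] at e
    rw [e, smul_eq_mul]
    field_simp)
  rw [fderiv_fderiv_apply hL] at this
  simpa using this

theorem fderiv_fderiv_symm {V : Type*} [NormedAddCommGroup V] [NormedSpace ℝ V] {L : V → ℝ}
    {z : V} (hL : ContDiffAt ℝ 2 L z) (X Y : V) :
    fderiv ℝ (fderiv ℝ L) z X Y = fderiv ℝ (fderiv ℝ L) z Y X :=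
  (hL.isSymmSndFDerivAt (by simp)) X Y

/-- `Z(g(𝒰,b)) = (Z g)(𝒰,b) + g(Z 𝒰,b)`, where `2 g(𝒰,b) = ∂L/∂v^b`. -/
theorem fderiv_fderiv_eq_fderiv_coordFundamental {L : E × E → ℝ} (hhom : IsHomogeneousTwo L)
    {z : E × E} (hL : ContDiffAt ℝ ∞ L z) (Z : E × E) (b : E) :
    fderiv ℝ (fderiv ℝ L) z Z (0, b) =
      2 * fderiv ℝ (fun z' => coordFundamental L z' z.2 b) z Z
        + 2 * coordFundamental L z Z.2 b := by
  have h2d : DifferentiableAt ℝ (fderiv ℝ (fderiv ℝ L)) z :=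
    ((hL.fderiv_right (m := ∞) (by simp)).fderiv_right (m := ∞) (by simp)).differentiableAt
      (by simp)
  have hL2 := contDiffAt_infty.1 hL 2
  have ev : ∀ᶠ z' in nhds z, ContDiffAt ℝ 2 L z' := hL2.eventually (by simp)
  -- Euler's identity holds on a neighbourhood, so it may be differentiated; the product rule then
  -- yields one term from `g` and one from the moving vector `z'.2`.
  have e : (fun z' => fderiv ℝ L z' ((0, b) : E × E)) =ᶠ[nhds z]
      fun z' => fderiv ℝ (fderiv ℝ L) z' (0, z'.2) (0, b) := by
    filter_upwards [ev] with y hy using (hhom.fderiv_fderiv_self hy b).symm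
  have hv : HasFDerivAt (fun z' : E × E => ((0, z'.2) : E × E))
      ((ContinuousLinearMap.inr ℝ E E).comp (ContinuousLinearMap.snd ℝ E E)) z :=
    ((ContinuousLinearMap.inr ℝ E E).comp (ContinuousLinearMap.snd ℝ E E)).hasFDerivAt
  have hd1 : DifferentiableAt ℝ (fun z' => fderiv ℝ (fderiv ℝ L) z' (0, z'.2)) z :=
    h2d.clm_apply hv.differentiableAt
  rw [← fderiv_fderiv_apply hL2, e.fderiv_eq, fderiv_clm_apply hd1 (differentiableAt_const _),
    fderiv_clm_apply h2d hv.differentiableAt, fderiv_coordFundamental hL,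
    coordFundamental_eq hL2, hv.fderiv]
  simp
  ring

/-! ### From the Chern axioms to the Euler–Lagrange equation. -/

namespace IsChernSymbol

variable {L : E × E → ℝ} {z : E × E} {Γ : E × E →ₗ[ℝ] E →ₗ[ℝ] E}

/-- By torsion-freeness both sides equal `Γ (a, 0) Z.1`: vertical directions carry no Christoffel
symbols. -/
theorem apply_eq_horizontal (h : IsChernSymbol L z Γ) (Z : E × E) (a : E) :
    Γ Z a = Γ (Z.1, 0) a :=
  (h.torsion_free Z (a, 0)).trans (h.torsion_free (Z.1, 0) (a, 0)).symm

/-- Along horizontal vectors the connection is metric. -/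
theorem fderiv_coordFundamental_horizontal (h : IsChernSymbol L z Γ) (X a b : E) :
    fderiv ℝ (fun z' => coordFundamental L z' a b) z (X, -(Γ (X, 0) z.2)) =
      coordFundamental L z (Γ (X, 0) a) b + coordFundamental L z a (Γ (X, 0) b) := by
  rw [h.almost_compatible, h.apply_eq_horizontal (X, -(Γ (X, 0) z.2)) a,
    h.apply_eq_horizontal (X, -(Γ (X, 0) z.2)) b,
    h.apply_eq_horizontal (X, -(Γ (X, 0) z.2)) z.2]
  -- On a horizontal vector `∇_Z 𝒰` vanishes, and with it the Cartan term.
  simp [coordCartan_zero_right]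

/-- `L` is constant along horizontal vectors. -/
theorem fderiv_horizontal (h : IsChernSymbol L z Γ) (hhom : IsHomogeneousTwo L)
    (hL : ContDiffAt ℝ ∞ L z) (X : E) : fderiv ℝ L z (X, -(Γ (X, 0) z.2)) = 0 := by
  have hL2 := contDiffAt_infty.1 hL 2
  have hd : DifferentiableAt ℝ (fderiv ℝ L) z :=
    (hL.fderiv_right (m := 1) (by norm_cast)).differentiableAt (by simp)
  have ev : ∀ᶠ z' in nhds z, ContDiffAt ℝ 2 L z' := hL2.eventually (by simp)
  -- With `N = Γ (X, 0) v` and `W = (X, -N)`, differentiating this identity along `W` gives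
  -- `-dL(0,N) + D²L(W,(0,v)) = 2 dL(W)`. Metricity along `W` gives `D²L(W,(0,v)) = 4g(N,v) -
  -- 2g(N,v) = dL(0,N)`, so the left side cancels.
  have e : (fun z' => fderiv ℝ L z' (0, z'.2)) =ᶠ[nhds z] fun z' => 2 * L z' := by
    filter_upwards [ev] with y hy using hhom.fderiv_self (hy.differentiableAt (by simp))
  have hv : HasFDerivAt (fun z' : E × E => ((0, z'.2) : E × E))
      ((ContinuousLinearMap.inr ℝ E E).comp (ContinuousLinearMap.snd ℝ E E)) z :=
    ((ContinuousLinearMap.inr ℝ E E).comp (ContinuousLinearMap.snd ℝ E E)).hasFDerivAt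
  have e2 := e.fderiv_eq (𝕜 := ℝ)
  have hdL : DifferentiableAt ℝ L z := hL2.differentiableAt (by simp)
  rw [fderiv_clm_apply hd hv.differentiableAt, hv.fderiv, fderiv_const_mul hdL] at e2
  have e3 := congrArg (fun A : E × E →L[ℝ] ℝ => A (X, -(Γ (X, 0) z.2))) e2
  have e4 := fderiv_fderiv_eq_fderiv_coordFundamental hhom hL (X, -(Γ (X, 0) z.2)) z.2
  rw [h.fderiv_coordFundamental_horizontal] at e4
  simp only [coordFundamental_eq hL2] at e4
  have e5 : ((0, -(Γ (X, 0) z.2)) : E × E) = -(0, Γ (X, 0) z.2) := by simp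
  have e6 := hhom.fderiv_fderiv_self hL2 (Γ (X, 0) z.2)
  rw [fderiv_fderiv_symm hL2 (0, Γ (X, 0) z.2) (0, z.2)] at e4
  rw [e5] at e4
  simp only [map_neg, neg_apply, fderiv_fderiv_symm hL2 (0, Γ (X, 0) z.2) (0, z.2), e6] at e4
  change fderiv ℝ L z (0, -(Γ (X, 0) z.2)) +
    fderiv ℝ (fderiv ℝ L) z (X, -(Γ (X, 0) z.2)) (0, z.2) =
      2 * fderiv ℝ L z (X, -(Γ (X, 0) z.2)) at e3
  rw [e4, e5, map_neg] at e3
  linarith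

/-- The horizontal lift of the canonical section solves the Euler–Lagrange equation. -/
theorem isSprayAt (h : IsChernSymbol L z Γ) (hhom : IsHomogeneousTwo L)
    (hL : ContDiffAt ℝ ∞ L z) : IsSprayAt L z (z.2, -(Γ (z.2, 0) z.2)) := by
  intro b
  have hL2 := contDiffAt_infty.1 hL 2
  have e1 := fderiv_fderiv_eq_fderiv_coordFundamental hhom hL (z.2, -(Γ (z.2, 0) z.2)) b
  have e2 := h.fderiv_horizontal hhom hL b
  have e3 : ((b, -(Γ (b, 0) z.2)) : E × E) = (b, 0) - (0, Γ (b, 0) z.2) := by simp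
  have e5 : ((0, -(Γ (z.2, 0) z.2)) : E × E) = -(0, Γ (z.2, 0) z.2) := by simp
  -- Metricity reduces the left side of the equation to `2g(v, Γ (v, 0) b)`; this swap turns it into
  -- `dL(0, Γ (b, 0) v)`, which is `dL(b, 0)` because `L` is constant along the horizontal lift of
  -- `b`.
  have e4 : Γ (z.2, 0) b = Γ (b, 0) z.2 := h.torsion_free (z.2, 0) (b, 0)
  rw [e3, map_sub] at e2
  rw [h.fderiv_coordFundamental_horizontal] at e1
  simp only [coordFundamental_eq hL2, e4, e5, map_neg, neg_apply,
    hhom.fderiv_fderiv_self hL2] at e1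
  rw [fderiv_fderiv_apply hL2, e1]
  linarith

end IsChernSymbol

/-- The Euler–Lagrange equation is invariant under the coordinate changes of a tangent bundle. -/
theorem IsSprayAt.comp {L : E × E → ℝ} {ψ : E → E} {Ψ : E × E → E × E} {z W : E × E}
    (hΨ : ∀ᶠ z' in nhds z, Ψ z' = (ψ z'.1, fderiv ℝ ψ z'.1 z'.2)) (hψ : ContDiffAt ℝ ∞ ψ z.1)
    (hL : ContDiffAt ℝ ∞ L (Ψ z)) (hW : W.1 = z.2) (h : IsSprayAt L (Ψ z) (fderiv ℝ Ψ z W)) :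
    IsSprayAt (L ∘ Ψ) z W := by
  have hψ2 : ContDiffAt ℝ 2 ψ z.1 := contDiffAt_infty.1 hψ 2
  have hψ' : ContDiffAt ℝ ∞ (fderiv ℝ ψ) z.1 := hψ.fderiv_right (by simp)
  have hL2 := contDiffAt_infty.1 hL 2
  have hΨs : ContDiffAt ℝ ∞ Ψ z := by
    refine ContDiffAt.congr_of_eventuallyEq ?_ hΨ
    exact (hψ.comp z contDiffAt_fst).prodMk ((hψ'.comp z contDiffAt_fst).clm_apply contDiffAt_snd)
  have hderiv : ∀ᶠ z' in nhds z, ∀ X : E × E, fderiv ℝ Ψ z' X =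
      (fderiv ℝ ψ z'.1 X.1, fderiv ℝ (fderiv ℝ ψ) z'.1 X.1 z'.2 + fderiv ℝ ψ z'.1 X.2) := by
    have ev1 : ∀ᶠ z' : E × E in nhds z, ContDiffAt ℝ 2 ψ z'.1 :=
      continuous_fst.continuousAt.eventually (hψ2.eventually (by simp))
    filter_upwards [hΨ.eventually_nhds, ev1] with z' hz' h1 X
    have d1 : DifferentiableAt ℝ ψ z'.1 := h1.differentiableAt (by simp)
    have d2 : DifferentiableAt ℝ (fderiv ℝ ψ) z'.1 :=
      (h1.fderiv_right (m := 1) (by norm_num)).differentiableAt (by simp)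
    have f1 : HasFDerivAt (fun z' : E × E => ψ z'.1)
        ((fderiv ℝ ψ z'.1).comp (ContinuousLinearMap.fst ℝ E E)) z' :=
      d1.hasFDerivAt.comp z' hasFDerivAt_fst
    have f2 : HasFDerivAt (fun z' : E × E => fderiv ℝ ψ z'.1)
        ((fderiv ℝ (fderiv ℝ ψ) z'.1).comp (ContinuousLinearMap.fst ℝ E E)) z' :=
      d2.hasFDerivAt.comp z' hasFDerivAt_fst
    have f3 := f1.prodMk (f2.clm_apply (hasFDerivAt_snd (𝕜 := ℝ) (p := z')))
    have e : Ψ =ᶠ[nhds z'] fun z' => (ψ z'.1, fderiv ℝ ψ z'.1 z'.2) := hz'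
    rw [e.fderiv_eq, f3.fderiv]
    simp [add_comm]
  have evL : ∀ᶠ z' in nhds z, DifferentiableAt ℝ L (Ψ z') :=
    hΨs.continuousAt.eventually ((hL2.eventually (by simp)).mono
      fun y hy => hy.differentiableAt (by simp))
  have evΨ : ∀ᶠ z' in nhds z, DifferentiableAt ℝ Ψ z' :=
    ((contDiffAt_infty.1 hΨs 1).eventually (by simp)).mono
      fun y hy => hy.differentiableAt (by simp)
  have hchain : ∀ᶠ z' in nhds z, ∀ X, fderiv ℝ (L ∘ Ψ) z' X = fderiv ℝ L (Ψ z') (fderiv ℝ Ψ z' X) := by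
    filter_upwards [evL, evΨ] with z' h1 h2 X
    rw [fderiv_comp z' h1 h2]; rfl
  intro b
  have e : (fun z' => fderiv ℝ (L ∘ Ψ) z' (0, b)) =ᶠ[nhds z]
      fun z' => fderiv ℝ L (Ψ z') (0, fderiv ℝ ψ z'.1 b) := by
    filter_upwards [hchain, hderiv] with z' h1 h2
    rw [h1, h2]; simp
  have dL : DifferentiableAt ℝ (fderiv ℝ L) (Ψ z) :=
    (hL2.fderiv_right (m := 1) (by norm_num)).differentiableAt (by simp)
  have dΨ : DifferentiableAt ℝ Ψ z := hΨs.differentiableAt (by simp)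
  have g1 : HasFDerivAt (fun z' => fderiv ℝ L (Ψ z'))
      ((fderiv ℝ (fderiv ℝ L) (Ψ z)).comp (fderiv ℝ Ψ z)) z :=
    dL.hasFDerivAt.comp z dΨ.hasFDerivAt
  have g2 : HasFDerivAt (fun z' : E × E => fderiv ℝ ψ z'.1)
      ((fderiv ℝ (fderiv ℝ ψ) z.1).comp (ContinuousLinearMap.fst ℝ E E)) z :=
    (hψ'.differentiableAt (by simp)).hasFDerivAt.comp z hasFDerivAt_fst
  have g3 := (ContinuousLinearMap.inr ℝ E E).hasFDerivAt.comp z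
    (g2.clm_apply (hasFDerivAt_const b z))
  have g4 := (g1.clm_apply g3).fderiv
  have g5 : (fun z' => fderiv ℝ L (Ψ z') ((⇑(ContinuousLinearMap.inr ℝ E E) ∘
      fun y : E × E => fderiv ℝ ψ y.1 b) z')) = fun z' => fderiv ℝ L (Ψ z') (0, fderiv ℝ ψ z'.1 b) := by
    funext z'; simp
  rw [g5] at g4
  have hb := h (fderiv ℝ ψ z.1 b)
  rw [fderiv_fderiv_apply hL2] at hb
  -- The chart change adds a term with `D²ψ(W.1, b)` on the left and one with `D²ψ(b, v)` on the
  -- right. They agree by symmetry, precisely because `W.1 = v`.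
  have hs : fderiv ℝ (fderiv ℝ ψ) z.1 z.2 b = fderiv ℝ (fderiv ℝ ψ) z.1 b z.2 :=
    (hψ2.isSymmSndFDerivAt (by simp)) _ _
  rw [e.fderiv_eq, g4, hchain.self_of_nhds, hderiv.self_of_nhds (b, 0)]
  have split : ((fderiv ℝ ψ z.1 b, fderiv ℝ (fderiv ℝ ψ) z.1 b z.2) : E × E) =
    (fderiv ℝ ψ z.1 b, 0) + (0, fderiv ℝ (fderiv ℝ ψ) z.1 b z.2) := by simp
  change fderiv ℝ L (Ψ z) (0, fderiv ℝ ψ z.1 0 + fderiv ℝ (fderiv ℝ ψ) z.1 W.1 b) +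
    fderiv ℝ (fderiv ℝ L) (Ψ z) (fderiv ℝ Ψ z W) (0, fderiv ℝ ψ z.1 b) =
    fderiv ℝ L (Ψ z) (fderiv ℝ ψ z.1 b, fderiv ℝ (fderiv ℝ ψ) z.1 b z.2 + fderiv ℝ ψ z.1 0)
  rw [hb, hW, hs, map_zero, add_zero, zero_add, split, map_add, add_comm]

/-! ### Solving the Euler–Lagrange equation for the spray. -/

variable (E) in
/-- Restriction of a bilinear form on `E × E` to the fibre directions. -/
def fiberHessian (B : E × E →L[ℝ] E × E →L[ℝ] ℝ) : E →L[ℝ] E →L[ℝ] ℝ :=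
  ((ContinuousLinearMap.compL ℝ E (E × E) ℝ).flip (ContinuousLinearMap.inr ℝ E E)).comp
    (B.comp (ContinuousLinearMap.inr ℝ E E))

theorem fiberHessian_apply (B : E × E →L[ℝ] E × E →L[ℝ] ℝ) (a b : E) :
    fiberHessian E B a b = B (0, a) (0, b) := rfl

/-- The fibre component of the solution of the Euler–Lagrange equation. -/
def sprayCoeff (L : E × E → ℝ) (z : E × E) : E :=
  (fiberHessian E (fderiv ℝ (fderiv ℝ L) z)).inverse
    ((fderiv ℝ L z).comp (ContinuousLinearMap.inl ℝ E E)
      - (fderiv ℝ (fderiv ℝ L) z (z.2, 0)).comp (ContinuousLinearMap.inr ℝ E E))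

/-- Once `W.1 = v` is fixed, the equation is linear in `W.2` with the fibre Hessian as its matrix.
Invertibility matters: elsewhere `inverse` is `0` by convention. -/
theorem IsSprayAt.eq_sprayCoeff {L : E × E → ℝ} {z W : E × E} (h : IsSprayAt L z W)
    (hL : ContDiffAt ℝ 2 L z) (hW : W.1 = z.2)
    (hinv : (fiberHessian E (fderiv ℝ (fderiv ℝ L) z)).IsInvertible) :
    W = (z.2, sprayCoeff L z) := by
  refine Prod.ext hW ?_
  have : (fderiv ℝ L z).comp (ContinuousLinearMap.inl ℝ E E)
      - (fderiv ℝ (fderiv ℝ L) z (z.2, 0)).comp (ContinuousLinearMap.inr ℝ E E) =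
      fiberHessian E (fderiv ℝ (fderiv ℝ L) z) W.2 := by
    ext b
    have e := h b
    rw [fderiv_fderiv_apply hL] at e
    have e1 : W = (z.2, 0) + (0, W.2) := by ext <;> simp [hW]
    rw [e1] at e
    simp only [map_add, add_apply] at e
    simp [fiberHessian_apply, ← e]
  rw [sprayCoeff, this]
  exact (hinv.inverse_apply_eq.2 rfl).symm

theorem isInvertible_fiberHessian [FiniteDimensional ℝ E] {L : E × E → ℝ} {z : E × E}
    (hL : ContDiffAt ℝ 2 L z) (hpos : ∀ a, a ≠ 0 → 0 < coordFundamental L z a a) :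
    (fiberHessian E (fderiv ℝ (fderiv ℝ L) z)).IsInvertible := by
  have hinj : Function.Injective (fiberHessian E (fderiv ℝ (fderiv ℝ L) z)) := by
    rw [injective_iff_map_eq_zero]
    intro a ha
    by_contra h
    have := hpos a h
    rw [coordFundamental_eq hL, ← fiberHessian_apply, ha] at this
    simp at this
  have hfin : Module.finrank ℝ E = Module.finrank ℝ (E →L[ℝ] ℝ) := by
    rw [← (LinearMap.toContinuousLinearMap : (E →ₗ[ℝ] ℝ) ≃ₗ[ℝ] _).finrank_eq]
    exact (Subspace.dual_finrank_eq (K := ℝ) (V := E)).symm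
  let e := LinearEquiv.ofInjectiveOfFinrankEq
    (fiberHessian E (fderiv ℝ (fderiv ℝ L) z)).toLinearMap hinj hfin
  exact ⟨e.toContinuousLinearEquiv, by ext; rfl⟩

theorem eventually_isInvertible_fiberHessian [CompleteSpace E] {L : E × E → ℝ} {z : E × E}
    (hL : ContDiffAt ℝ ∞ L z)
    (hinv : (fiberHessian E (fderiv ℝ (fderiv ℝ L) z)).IsInvertible) :
    ∀ᶠ z' in nhds z, (fiberHessian E (fderiv ℝ (fderiv ℝ L) z')).IsInvertible := by
  have h2 : ContinuousAt (fderiv ℝ (fderiv ℝ L)) z :=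
    ((hL.fderiv_right (m := ∞) (by simp)).fderiv_right (m := ∞) (by simp)).continuousAt
  have hc : ContinuousAt (fun z' => fiberHessian E (fderiv ℝ (fderiv ℝ L) z')) z := by
    unfold fiberHessian
    fun_prop
  obtain ⟨e, he⟩ := hinv
  exact hc.eventually (by simp only [← he]; exact ContinuousLinearEquiv.nhds e)

/-- Inversion of operators is smooth at invertible ones, and every other ingredient is a derivative
of `L`. -/
theorem contDiffAt_sprayCoeff [CompleteSpace E] {L : E × E → ℝ} {z : E × E}
    (hL : ContDiffAt ℝ ∞ L z)
    (hinv : (fiberHessian E (fderiv ℝ (fderiv ℝ L) z)).IsInvertible) :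
    ContDiffAt ℝ ∞ (sprayCoeff L) z := by
  have h1 : ContDiffAt ℝ ∞ (fderiv ℝ L) z := hL.fderiv_right (by simp)
  have h2 : ContDiffAt ℝ ∞ (fderiv ℝ (fderiv ℝ L)) z := h1.fderiv_right (by simp)
  have h3 : ContDiffAt ℝ ∞ (fun z' => fiberHessian E (fderiv ℝ (fderiv ℝ L) z')) z := by
    unfold fiberHessian
    exact contDiffAt_const.clm_comp (h2.clm_comp contDiffAt_const)
  refine ContDiffAt.clm_apply (ContDiffAt.comp (g := ContinuousLinearMap.inverse) z
    hinv.contDiffAt_map_inverse h3) ?_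
  exact (h1.clm_comp contDiffAt_const).sub
    ((h2.clm_apply (contDiffAt_snd.prodMk contDiffAt_const)).clm_comp contDiffAt_const)

/-- The bracket of a spray with the Liouville field. -/
theorem lieBracket_spray_liouville {w : E × E → E} {z : E × E} (hw : DifferentiableAt ℝ w z)
    (hhom : ∀ᶠ c in nhds (1 : ℝ), w (z.1, c • z.2) = c ^ 2 • w z) :
    VectorField.lieBracket ℝ (fun z' : E × E => (z'.2, w z')) (fun z' => (0, z'.2)) z =
      -(z.2, w z) := by
  have h1 : HasFDerivAt (fun z' : E × E => (z'.2, w z'))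
    ((ContinuousLinearMap.snd ℝ E E).prod (fderiv ℝ w z)) z :=
    hasFDerivAt_snd.prodMk hw.hasFDerivAt
  have h2 : HasFDerivAt (fun z' : E × E => ((0, z'.2) : E × E))
      ((ContinuousLinearMap.inr ℝ E E).comp (ContinuousLinearMap.snd ℝ E E)) z :=
    ((ContinuousLinearMap.inr ℝ E E).comp (ContinuousLinearMap.snd ℝ E E)).hasFDerivAt
  have h3 := fderiv_fiber_of_homogeneous hw hhom
  rw [VectorField.lieBracket, h1.fderiv, h2.fderiv]
  simp [h3, two_smul]

end Spray

/-! ### Vector fields and their brackets in a chart. -/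

section LocalExpressions

variable {E : Type*} [NormedAddCommGroup E] [NormedSpace ℝ E] {H : Type*} [TopologicalSpace H]
  {I : ModelWithCorners ℝ E H} {M : Type*} [TopologicalSpace M] [ChartedSpace H M]
  [IsManifold I 1 M]

theorem mfderiv_extChartAt_eq_tangentCoordChange {x y : M} (h : x ∈ (chartAt H y).source) :
    mfderiv I 𝓘(ℝ, E) (extChartAt I y) x = tangentCoordChange I x y x :=
  (mdifferentiableAt_extChartAt h).mfderiv.trans rfl

/-- The components of a vector field in the chart at `p`, at the point with coordinates `z`. -/
def localField (V : ∀ x : M, TangentSpace I x) (p : M) (z : E) : E :=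
  tangentCoordChange I ((extChartAt I p).symm z) p ((extChartAt I p).symm z)
    (V ((extChartAt I p).symm z))

theorem mpullbackWithin_extChartAt_symm (V : ∀ x : M, TangentSpace I x) (p : M) {z : E}
    (hz : z ∈ (extChartAt I p).target) :
    VectorField.mpullbackWithin 𝓘(ℝ, E) I (extChartAt I p).symm V (Set.range I) z =
      localField V p z := by
  have hsrc := (extChartAt I p).map_target hz
  have h1 := mfderivWithin_extChartAt_symm_comp_mfderiv_extChartAt hz
  rw [VectorField.mpullbackWithin_apply, localField]
  refine (isInvertible_mfderivWithin_extChartAt_symm hz).inverse_apply_eq.2 ?_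
  rw [← mfderiv_extChartAt_eq_tangentCoordChange (by rwa [extChartAt_source] at hsrc)]
  exact (congrArg (fun A : TangentSpace I ((extChartAt I p).symm z) →L[ℝ] _ =>
    A (V ((extChartAt I p).symm z))) h1).symm

/-- The Lie bracket is the bracket of the components in the preferred chart. -/
theorem mlieBracket_eq_lieBracket_localField [I.Boundaryless] (V W : ∀ x : M, TangentSpace I x)
    (p : M) : VectorField.mlieBracket I V W p =
      VectorField.lieBracket ℝ (localField V p) (localField W p) (extChartAt I p p) := by
  have hr : Set.range I = Set.univ := ModelWithCorners.range_eq_univ _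
  have ev : ∀ V : ∀ x : M, TangentSpace I x,
      VectorField.mpullbackWithin 𝓘(ℝ, E) I (extChartAt I p).symm V (Set.range I)
        =ᶠ[nhds (extChartAt I p p)] localField V p := fun V => by
    filter_upwards [extChartAt_target_mem_nhds (I := I) p] with z hz
      using mpullbackWithin_extChartAt_symm V p hz
  -- Tangent vectors at `p` are already expressed in the preferred chart at `p`, so pulling the
  -- bracket back changes nothing.
  have hid : mfderiv I 𝓘(ℝ, E) (extChartAt I p) p = ContinuousLinearMap.id ℝ E := by
    rw [mfderiv_extChartAt_eq_tangentCoordChange (mem_chart_source H p)]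
    ext v
    exact tangentCoordChange_self (mem_extChartAt_source p)
  rw [← VectorField.mlieBracketWithin_univ, VectorField.mlieBracketWithin_apply, hid]
  refine (congrArg (fun A : E →L[ℝ] E => A _) ContinuousLinearMap.inverse_id).trans ?_
  refine Eq.trans ?_ ((ev V).lieBracket_vectorField_eq (ev W))
  have hs : (extChartAt I p).symm ⁻¹' Set.univ ∩ Set.range I = Set.univ := by simp [hr]
  exact (congrArg (fun s => VectorField.lieBracketWithin ℝ _ _ s _) hs).trans
    (congrFun VectorField.lieBracketWithin_univ _)

theorem contMDiffAt_of_localField [IsManifold I ∞ M]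
    {V : ∀ x : M, TangentSpace I x} {p : M}
    (h : ContDiffAt ℝ ∞ (localField V p) (extChartAt I p p)) :
    ContMDiffAt I I.tangent ∞ (fun x => (⟨x, V x⟩ : TangentBundle I M)) p := by
  refine (contMDiffAt_section p).2 ?_
  have h1 : ContMDiffAt I 𝓘(ℝ, E) ∞ (fun x => localField V p (extChartAt I p x)) p :=
    h.contMDiffAt.comp p contMDiffAt_extChartAt
  refine h1.congr_of_eventuallyEq ?_
  filter_upwards [extChartAt_source_mem_nhds (I := I) p] with x hx
  rw [localField, (extChartAt I p).left_inv hx]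
  rfl

end LocalExpressions

/-! ### Chart changes of the tangent bundle. -/

section Transition

variable {E : Type*} [NormedAddCommGroup E] [NormedSpace ℝ E]
  {M : Type*} [TopologicalSpace M] [ChartedSpace E M] [IsManifold 𝓘(ℝ, E) ∞ M]

/-- The transition map between the charts of the tangent bundle at `p` and at `q`. -/
def transition (p q : TangentBundle 𝓘(ℝ, E) M) : E × E → E × E :=
  extChartAt 𝓘(ℝ, E).tangent q ∘ (extChartAt 𝓘(ℝ, E).tangent p).symm

/-- The transition map between the charts of `M` at `x` and at `y`. -/
def baseTransition (x y : M) : E → E :=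
  extChartAt 𝓘(ℝ, E) y ∘ (extChartAt 𝓘(ℝ, E) x).symm

theorem mem_extChartAt_tangent_source {p q : TangentBundle 𝓘(ℝ, E) M} :
    p ∈ (extChartAt 𝓘(ℝ, E).tangent q).source ↔ p.proj ∈ (extChartAt 𝓘(ℝ, E) q.proj).source := by
  rw [extChartAt_source, extChartAt_source]
  exact TangentBundle.mem_chart_source_iff p q

theorem transition_eq {p q : TangentBundle 𝓘(ℝ, E) M} {z : E × E}
    (hz : z ∈ (extChartAt 𝓘(ℝ, E).tangent p).target)
    (hq : (extChartAt 𝓘(ℝ, E).tangent p).symm z ∈ (extChartAt 𝓘(ℝ, E).tangent q).source) :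
    transition p q z = (baseTransition p.proj q.proj z.1,
      fderiv ℝ (baseTransition p.proj q.proj) z.1 z.2) := by
  have hp := (extChartAt 𝓘(ℝ, E).tangent p).map_target hz
  rw [mem_extChartAt_tangent_source] at hp hq
  have e1 : extChartAt 𝓘(ℝ, E) p.proj ((extChartAt 𝓘(ℝ, E) p.proj).symm z.1) = z.1 :=
    congrArg Prod.fst ((extChartAt 𝓘(ℝ, E).tangent p).right_inv hz)
  refine Prod.ext rfl ?_
  -- A fibre vector passes through the preferred chart at its own base point; the cocycle identity
  -- removes this intermediate chart.
  have e2 := tangentCoordChange_comp (I := 𝓘(ℝ, E)) (w := p.proj)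
    (x := (extChartAt 𝓘(ℝ, E) p.proj).symm z.1) (y := q.proj)
    (z := (extChartAt 𝓘(ℝ, E) p.proj).symm z.1) (v := z.2)
    ⟨⟨hp, mem_extChartAt_source _⟩, hq⟩
  refine Eq.trans e2 ?_
  rw [tangentCoordChange_def, e1, ModelWithCorners.range_eq_univ, fderivWithin_univ]
  rfl

theorem eventually_transition_eq {p q : TangentBundle 𝓘(ℝ, E) M} {z : E × E}
    (hz : z ∈ (extChartAt 𝓘(ℝ, E).tangent p).target)
    (hq : (extChartAt 𝓘(ℝ, E).tangent p).symm z ∈ (extChartAt 𝓘(ℝ, E).tangent q).source) :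
    ∀ᶠ z' in nhds z, z' ∈ (extChartAt 𝓘(ℝ, E).tangent p).target ∧
      (extChartAt 𝓘(ℝ, E).tangent p).symm z' ∈ (extChartAt 𝓘(ℝ, E).tangent q).source :=
  Filter.Eventually.and ((isOpen_extChartAt_target (I := 𝓘(ℝ, E).tangent) p).mem_nhds hz)
    ((continuousAt_extChartAt_symm'' hz).eventually
      ((isOpen_extChartAt_source (I := 𝓘(ℝ, E).tangent) q).mem_nhds hq))

theorem contDiffAt_baseTransition {x y : M} {a : E} (ha : a ∈ (extChartAt 𝓘(ℝ, E) x).target)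
    (hy : (extChartAt 𝓘(ℝ, E) x).symm a ∈ (extChartAt 𝓘(ℝ, E) y).source) :
    ContDiffAt ℝ ∞ (baseTransition x y) a := by
  have := contDiffWithinAt_ext_coord_change (I := 𝓘(ℝ, E)) (n := ∞) y x (y := a) ⟨ha, hy⟩
  rwa [ModelWithCorners.range_eq_univ, contDiffWithinAt_univ] at this

theorem differentiableAt_transition {p q : TangentBundle 𝓘(ℝ, E) M} {z : E × E}
    (hz : z ∈ (extChartAt 𝓘(ℝ, E).tangent p).target)
    (hq : (extChartAt 𝓘(ℝ, E).tangent p).symm z ∈ (extChartAt 𝓘(ℝ, E).tangent q).source) :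
    DifferentiableAt ℝ (transition p q) z := by
  have := contDiffWithinAt_ext_coord_change (I := 𝓘(ℝ, E).tangent) (n := 1) q p (y := z) ⟨hz, hq⟩
  rw [ModelWithCorners.range_eq_univ, contDiffWithinAt_univ] at this
  exact this.differentiableAt (by simp)

theorem tangentCoordChange_eq_fderiv_transition (p q r : TangentBundle 𝓘(ℝ, E) M) :
    tangentCoordChange 𝓘(ℝ, E).tangent p q r =
      fderiv ℝ (transition p q) (extChartAt 𝓘(ℝ, E).tangent p r) := by
  rw [tangentCoordChange_def, ModelWithCorners.range_eq_univ, fderivWithin_univ]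
  rfl

theorem fderiv_transition_fst {p q : TangentBundle 𝓘(ℝ, E) M} {z : E × E}
    (hz : z ∈ (extChartAt 𝓘(ℝ, E).tangent p).target)
    (hq : (extChartAt 𝓘(ℝ, E).tangent p).symm z ∈ (extChartAt 𝓘(ℝ, E).tangent q).source)
    (w : E) : (fderiv ℝ (transition p q) z (z.2, w)).1 = (transition p q z).2 := by
  have h1 := (differentiableAt_transition hz hq).hasFDerivAt.fst
  have hp := (extChartAt 𝓘(ℝ, E).tangent p).map_target hz
  have e1 : extChartAt 𝓘(ℝ, E) p.proj ((extChartAt 𝓘(ℝ, E) p.proj).symm z.1) = z.1 :=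
    congrArg Prod.fst ((extChartAt 𝓘(ℝ, E).tangent p).right_inv hz)
  have ha : z.1 ∈ (extChartAt 𝓘(ℝ, E) p.proj).target := by
    rw [← e1]
    exact (extChartAt 𝓘(ℝ, E) p.proj).map_source (mem_extChartAt_tangent_source.1 hp)
  have h2 : HasFDerivAt (fun z' : E × E => baseTransition p.proj q.proj z'.1)
      ((fderiv ℝ (baseTransition p.proj q.proj) z.1).comp (ContinuousLinearMap.fst ℝ E E)) z :=
    ((contDiffAt_baseTransition ha (mem_extChartAt_tangent_source.1 hq)).differentiableAt
      (by simp)).hasFDerivAt.comp z hasFDerivAt_fst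
  have h3 := h1.unique h2
  rw [transition_eq hz hq]
  exact congrArg (fun A : E × E →L[ℝ] E => A (z.2, w)) h3

/-- Transitions have fibre degree zero in the base part and one in the fibre part, so Euler's
identity applies to each. Hence the Liouville field looks the same in all charts. -/
theorem fderiv_transition_vertical {p q : TangentBundle 𝓘(ℝ, E) M} {z : E × E}
    (hz : z ∈ (extChartAt 𝓘(ℝ, E).tangent p).target)
    (hq : (extChartAt 𝓘(ℝ, E).tangent p).symm z ∈ (extChartAt 𝓘(ℝ, E).tangent q).source) :
    fderiv ℝ (transition p q) z (0, z.2) = (0, (transition p q z).2) := by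
  have hd := differentiableAt_transition hz hq
  have hev : ∀ᶠ c : ℝ in nhds 1, transition p q (z.1, c • z.2) =
      ((transition p q z).1, c • (transition p q z).2) := by
    have hc := (hasDerivAt_fiber_smul z).continuousAt
    have ht : Filter.Tendsto (fun c : ℝ => ((z.1, c • z.2) : E × E)) (nhds 1) (nhds z) := by
      simpa [ContinuousAt] using hc
    filter_upwards [ht.eventually (eventually_transition_eq hz hq)] with c hc'
    rw [transition_eq hc'.1 hc'.2, transition_eq hz hq]
    simp
  have h1 := fderiv_fiber_of_homogeneous (m := 0) hd.fst
    (by filter_upwards [hev] with c hc; simp [hc])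
  have h2 := fderiv_fiber_of_homogeneous (m := 1) hd.snd
    (by filter_upwards [hev] with c hc; simp [hc])
  rw [hd.hasFDerivAt.fst.fderiv] at h1
  rw [hd.hasFDerivAt.snd.fderiv] at h2
  refine Prod.ext ?_ ?_
  · simpa using h1
  · simpa using h2

end Transition

/-! ### Identities for the energy and functions of it. -/

section Energy

variable {E : Type*} [NormedAddCommGroup E] [NormedSpace ℝ E]

theorem IsSprayAt.congr {L L' : E × E → ℝ} {z W : E × E} (h : IsSprayAt L z W)
    (e : L' =ᶠ[nhds z] L) : IsSprayAt L' z W := fun b => by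
  have e1 : (fun z' => fderiv ℝ L' z' ((0, b) : E × E)) =ᶠ[nhds z] fun z' => fderiv ℝ L z' (0, b) := by
    filter_upwards [e.eventually_nhds] with z' hz'
    rw [Filter.EventuallyEq.fderiv_eq (𝕜 := ℝ) hz']
  rw [e1.fderiv_eq, e.fderiv_eq, h b]

theorem coordFundamental_symm {L : E × E → ℝ} {z : E × E} (hL : ContDiffAt ℝ 2 L z) (a b : E) :
    coordFundamental L z a b = coordFundamental L z b a := by
  rw [coordFundamental_eq hL, coordFundamental_eq hL, fderiv_fderiv_symm hL]

theorem IsHomogeneousTwo.coordFundamental_self {L : E × E → ℝ} (hhom : IsHomogeneousTwo L)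
    {z : E × E} (hL : ContDiffAt ℝ 2 L z) : coordFundamental L z z.2 z.2 = L z := by
  rw [coordFundamental_eq hL, hhom.fderiv_fderiv_self hL,
    hhom.fderiv_self (hL.differentiableAt (by simp))]
  ring

/-- A vector that annihilates the energy annihilates every function of the energy. -/
theorem fderiv_eq_zero_of_eq_comp {L f : E × E → ℝ} {k : ℝ → ℝ} {z W : E × E}
    (hhom : IsHomogeneousTwo L) (hL : DifferentiableAt ℝ L z) (hpos : 0 < L z)
    (hf : DifferentiableAt ℝ f z) (e : ∀ᶠ z' in nhds z, f z' = k (L z'))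
    (hW : fderiv ℝ L z W = 0) : fderiv ℝ f z W = 0 := by
  -- The fibre ray through `z`, parametrised by the value of `L`. Near `z` it gives `f = (f ∘ γ) ∘
  -- L` with `f ∘ γ` differentiable, so no regularity of `k` is needed.
  let γ : ℝ → E × E := fun s => (z.1, Real.sqrt (s / L z) • z.2)
  have hγz : γ (L z) = z := by simp [γ, hpos.ne']
  have hγ : DifferentiableAt ℝ γ (L z) := by
    refine (differentiableAt_const _).prodMk (DifferentiableAt.smul_const ?_ _)
    refine DifferentiableAt.sqrt (differentiableAt_id.div_const _) ?_
    simp [hpos.ne']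
  have hLγ : ∀ s, 0 < s → L (γ s) = s := fun s hs => by
    have h1 := hhom (Real.sqrt (s / L z)) (Real.sqrt_pos.2 (by positivity)) z
    rw [Real.sq_sqrt (by positivity), div_mul_cancel₀ _ hpos.ne'] at h1
    exact h1
  have hγL : Filter.Tendsto (fun z' => γ (L z')) (nhds z) (nhds z) := by
    have : ContinuousAt (fun z' => γ (L z')) z :=
      ContinuousAt.comp (g := γ) hγ.continuousAt hL.continuousAt
    simpa only [ContinuousAt, hγz] using this
  have ev : f =ᶠ[nhds z] (f ∘ γ) ∘ L := by
    filter_upwards [e, hγL.eventually e, hL.continuousAt.eventually (lt_mem_nhds hpos)]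
      with z' h1 h2 h3
    simp only [Function.comp_apply]
    rw [h1, h2, hLγ _ h3]
  have hfγ : DifferentiableAt ℝ (f ∘ γ) (L z) :=
    DifferentiableAt.comp (L z) (by rwa [hγz]) hγ
  rw [ev.fderiv_eq, fderiv_comp z hfγ hL, ContinuousLinearMap.comp_apply, hW, map_zero]

end Energy

/-! ### The Liouville and geodesic fields on the slit tangent bundle. -/

section SlitTangentBundle

variable {E : Type*} [NormedAddCommGroup E] [NormedSpace ℝ E]
  {M : Type*} [TopologicalSpace M] [ChartedSpace E M] [IsManifold 𝓘(ℝ, E) ∞ M]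

/-- The Liouville field `u ↦ u^v`. -/
def liouvilleField (p : TangentBundle 𝓘(ℝ, E) M) : TangentSpace 𝓘(ℝ, E).tangent p :=
  verticalLift p p.2

theorem coord_snd (p : TangentBundle 𝓘(ℝ, E) M) : (coord p).2 = p.2 :=
  congrArg Prod.snd (coord_eq p)

/-- The value of `V` at `q` is stored in the preferred chart at `q`, and the transition carries it
to the chart at `p`. -/
theorem localField_eq_fderiv_transition
    (V : ∀ p : TangentBundle 𝓘(ℝ, E) M, TangentSpace 𝓘(ℝ, E).tangent p)
    {p q : TangentBundle 𝓘(ℝ, E) M} {z : E × E}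
    (hq : (extChartAt 𝓘(ℝ, E).tangent p).symm z = q) :
    localField V p z = fderiv ℝ (transition q p) (coord q) (V q) := by
  subst hq
  rw [localField, tangentCoordChange_eq_fderiv_transition]
  rfl

theorem transition_coord {p q : TangentBundle 𝓘(ℝ, E) M} {z : E × E}
    (hz : z ∈ (extChartAt 𝓘(ℝ, E).tangent p).target)
    (hq : (extChartAt 𝓘(ℝ, E).tangent p).symm z = q) : transition q p (coord q) = z := by
  have h : (extChartAt 𝓘(ℝ, E).tangent q).symm (coord q) = q := extChartAt_to_inv q
  rw [transition, Function.comp_apply, h, ← hq]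
  exact (extChartAt 𝓘(ℝ, E).tangent p).right_inv hz

theorem localField_liouvilleField {p : TangentBundle 𝓘(ℝ, E) M} {z : E × E}
    (hz : z ∈ (extChartAt 𝓘(ℝ, E).tangent p).target) :
    localField (liouvilleField (E := E) (M := M)) p z = (0, z.2) := by
  obtain ⟨q, hq⟩ : ∃ q, (extChartAt 𝓘(ℝ, E).tangent p).symm z = q := ⟨_, rfl⟩
  have hs : (extChartAt 𝓘(ℝ, E).tangent q).symm (coord q) = q := extChartAt_to_inv q
  have hp := (extChartAt 𝓘(ℝ, E).tangent p).map_target hz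
  have h := fderiv_transition_vertical (p := q) (q := p) (z := coord q)
    (mem_extChartAt_target q) (by rw [hs, ← hq]; exact hp)
  rw [transition_coord hz hq, coord_snd] at h
  rw [localField_eq_fderiv_transition _ hq]
  exact h

theorem isSmoothField_liouvilleField : IsSmoothField (liouvilleField (E := E) (M := M)) :=
  fun p _ => by
    refine ContMDiffAt.contMDiffWithinAt (contMDiffAt_of_localField ?_)
    have e : localField (liouvilleField (E := E) (M := M)) p
        =ᶠ[nhds (extChartAt 𝓘(ℝ, E).tangent p p)] fun z => (0, z.2) := by
      filter_upwards [extChartAt_target_mem_nhds (I := 𝓘(ℝ, E).tangent) p] with z hz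
        using localField_liouvilleField hz
    exact (contDiffAt_const.prodMk contDiffAt_snd).congr_of_eventuallyEq e

namespace FinslerNorm

variable (F : FinslerNorm E M) {p : TangentBundle 𝓘(ℝ, E) M}

theorem isHomogeneousTwo_coordSq (p : TangentBundle 𝓘(ℝ, E) M) :
    IsHomogeneousTwo (F.coordSq p) := F.coordSq_smul p

theorem coordSq_coord (p : TangentBundle 𝓘(ℝ, E) M) : F.coordSq p (coord p) = F.toFun p ^ 2 := by
  have h : (extChartAt 𝓘(ℝ, E).tangent p).symm (coord p) = p := extChartAt_to_inv p
  rw [coordSq, h]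

theorem g_symm (hp : p ∈ slit E M) (a b : TangentSpace 𝓘(ℝ, E) p.proj) :
    F.g p a b = F.g p b a :=
  (F.g_eq_coordFundamental hp a b).trans
    ((coordFundamental_symm (contDiffAt_infty.1 (F.contDiffAt_coordSq hp) 2) a b).trans
      (F.g_eq_coordFundamental hp b a).symm)

/-- `g_u(u,u) = F(u)²`. -/
theorem g_self (hp : p ∈ slit E M) : F.g p p.2 p.2 = F.toFun p ^ 2 := by
  have hL := contDiffAt_infty.1 (F.contDiffAt_coordSq hp) 2
  have h := (F.isHomogeneousTwo_coordSq p).coordFundamental_self hL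
  rw [coordSq_coord, coord_snd] at h
  exact (F.g_eq_coordFundamental hp p.2 p.2).trans h

theorem sq_pos (hp : p ∈ slit E M) : 0 < F.toFun p ^ 2 := by
  rw [← F.g_self hp]
  exact F.posDef p hp _ hp

variable [FiniteDimensional ℝ E]

theorem isChernSymbol_chernSymbol (hp : p ∈ slit E M) :
    IsChernSymbol (F.coordSq p) (coord p) (F.chernSymbol p) := by
  rw [chernSymbol, dif_pos hp]
  exact (F.existsUnique_chernSymbol hp).choose_spec.1

theorem geodesicField_eq (p : TangentBundle 𝓘(ℝ, E) M) : F.geodesicField p =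
    ((((coord p).2, -(F.chernSymbol p ((coord p).2, 0) (coord p).2)) : E × E)) := by
  rw [coord_snd]
  rfl

theorem isSprayAt_geodesicField (hp : p ∈ slit E M) :
    IsSprayAt (F.coordSq p) (coord p) (F.geodesicField p) := by
  have := (F.isChernSymbol_chernSymbol hp).isSprayAt (F.isHomogeneousTwo_coordSq p)
    (F.contDiffAt_coordSq hp)
  rw [geodesicField_eq]
  exact this

/-- The components of the geodesic field solve the Euler–Lagrange equation of `F²` in every
chart. -/
theorem isSprayAt_localField_geodesicField {z : E × E}
    (hz : z ∈ (extChartAt 𝓘(ℝ, E).tangent p).target)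
    (hslit : (extChartAt 𝓘(ℝ, E).tangent p).symm z ∈ slit E M) :
    IsSprayAt (F.coordSq p) z (localField F.geodesicField p z) ∧
      (localField F.geodesicField p z).1 = z.2 := by
  obtain ⟨q, hq⟩ : ∃ q, (extChartAt 𝓘(ℝ, E).tangent p).symm z = q := ⟨_, rfl⟩
  have hs : (extChartAt 𝓘(ℝ, E).tangent q).symm (coord q) = q := extChartAt_to_inv q
  have hp := (extChartAt 𝓘(ℝ, E).tangent p).map_target hz
  have hqp : (extChartAt 𝓘(ℝ, E).tangent q).symm (coord q) ∈
    (extChartAt 𝓘(ℝ, E).tangent p).source := by rw [hs, ← hq]; exact hp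
  have hqq : (extChartAt 𝓘(ℝ, E).tangent p).symm z ∈ (extChartAt 𝓘(ℝ, E).tangent q).source := by
    rw [hq]; exact mem_extChartAt_source q
  have hW1 : (localField F.geodesicField p z).1 = z.2 := by
    rw [localField_eq_fderiv_transition _ hq, geodesicField_eq,
      fderiv_transition_fst (z := coord q) (mem_extChartAt_target q) hqp, transition_coord hz hq]
  refine ⟨?_, hW1⟩
  have hev := eventually_transition_eq hz hqq
  have hΨz : transition p q z = coord q := by
    rw [transition, Function.comp_apply, hq]; rfl
  have hpz : extChartAt 𝓘(ℝ, E).tangent p q = z := by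
    rw [← hq]; exact (extChartAt 𝓘(ℝ, E).tangent p).right_inv hz
  -- Carried back to its own chart at `q`, the vector is the one for which the Chern axioms give the
  -- Euler–Lagrange equation; `IsSprayAt.comp` then transports that equation to the chart at `p`.
  have hback : fderiv ℝ (transition p q) z (localField F.geodesicField p z) =
      F.geodesicField q := by
    have e := tangentCoordChange_comp (I := 𝓘(ℝ, E).tangent) (w := q) (x := p) (y := q) (z := q)
      (v := F.geodesicField q)
      ⟨⟨mem_extChartAt_source q, by rw [← hq]; exact hp⟩, mem_extChartAt_source q⟩
    have e0 := e.trans (tangentCoordChange_self (mem_extChartAt_source q))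
    rw [tangentCoordChange_eq_fderiv_transition p q q, hpz,
      tangentCoordChange_eq_fderiv_transition q p q] at e0
    rw [localField_eq_fderiv_transition _ hq]
    exact e0
  have hqs : q ∈ slit E M := hq ▸ hslit
  have key := IsSprayAt.comp (L := F.coordSq q) (ψ := baseTransition p.proj q.proj)
    (Ψ := transition p q) (z := z) (W := localField F.geodesicField p z)
    (hev.mono fun z' h => transition_eq h.1 h.2) ?_ ?_ hW1 ?_
  · refine key.congr ?_
    filter_upwards [hev] with z' h
    have e := (extChartAt 𝓘(ℝ, E).tangent q).left_inv h.2
    rw [Function.comp_apply, coordSq, coordSq, transition, Function.comp_apply, e]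
  · have e1 : extChartAt 𝓘(ℝ, E) p.proj ((extChartAt 𝓘(ℝ, E) p.proj).symm z.1) = z.1 :=
      congrArg Prod.fst ((extChartAt 𝓘(ℝ, E).tangent p).right_inv hz)
    refine contDiffAt_baseTransition ?_ (mem_extChartAt_tangent_source.1 hqq)
    rw [← e1]
    exact (extChartAt 𝓘(ℝ, E) p.proj).map_source (mem_extChartAt_tangent_source.1 hp)
  · rw [hΨz]; exact F.contDiffAt_coordSq hqs
  · rw [hΨz, hback]; exact F.isSprayAt_geodesicField hqs

theorem isInvertible_fiberHessian_coordSq (hp : p ∈ slit E M) :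
    (fiberHessian E (fderiv ℝ (fderiv ℝ (F.coordSq p)) (coord p))).IsInvertible :=
  isInvertible_fiberHessian (contDiffAt_infty.1 (F.contDiffAt_coordSq hp) 2) fun a ha =>
    (F.posDef p hp a ha).trans_eq (F.g_eq_coordFundamental hp a a)

/-- Near `p` the components of the geodesic field are the Euler–Lagrange coefficients of `F²`. -/
theorem eventually_localField_geodesicField (hp : p ∈ slit E M) :
    ∀ᶠ z in nhds (coord p), IsSprayAt (F.coordSq p) z (z.2, sprayCoeff (F.coordSq p) z) ∧
      ContDiffAt ℝ 2 (F.coordSq p) z ∧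
      (fiberHessian E (fderiv ℝ (fderiv ℝ (F.coordSq p)) z)).IsInvertible ∧
      localField F.geodesicField p z = (z.2, sprayCoeff (F.coordSq p) z) := by
  have : CompleteSpace E := FiniteDimensional.complete ℝ E
  have hL := F.contDiffAt_coordSq hp
  have hs : (extChartAt 𝓘(ℝ, E).tangent p).symm (extChartAt 𝓘(ℝ, E).tangent p p) = p :=
    extChartAt_to_inv p
  have ev1 : ∀ᶠ z in nhds (coord p), (extChartAt 𝓘(ℝ, E).tangent p).symm z ∈ slit E M := by
    have hc := continuousAt_extChartAt_symm (I := 𝓘(ℝ, E).tangent) p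
    refine hc.eventually ?_
    rw [hs]
    exact slit_mem_nhds hp
  filter_upwards [ev1, extChartAt_target_mem_nhds (I := 𝓘(ℝ, E).tangent) p,
    eventually_isInvertible_fiberHessian hL (F.isInvertible_fiberHessian_coordSq hp),
    (contDiffAt_infty.1 hL 2).eventually (by simp)] with z h1 h2 h3 h4
  obtain ⟨h5, h6⟩ := F.isSprayAt_localField_geodesicField h2 h1
  have h7 := h5.eq_sprayCoeff h4 h6 h3
  exact ⟨h7 ▸ h5, h4, h3, h7⟩

theorem contDiffAt_sprayCoeff_coordSq (hp : p ∈ slit E M) :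
    ContDiffAt ℝ ∞ (sprayCoeff (F.coordSq p)) (coord p) :=
  have : CompleteSpace E := FiniteDimensional.complete ℝ E
  contDiffAt_sprayCoeff (F.contDiffAt_coordSq hp) (F.isInvertible_fiberHessian_coordSq hp)

/-- Needed because `HasPotential` may be tested on smooth fields only, and `ζ` itself serves as a
test field. -/
theorem isSmoothField_geodesicField : IsSmoothField F.geodesicField := fun p hp => by
  refine ContMDiffAt.contMDiffWithinAt (contMDiffAt_of_localField ?_)
  exact (contDiffAt_snd.prodMk (F.contDiffAt_sprayCoeff_coordSq hp)).congr_of_eventuallyEq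
    ((F.eventually_localField_geodesicField hp).mono fun z h => h.2.2.2)

/-- `[ζ, 𝓛] = -ζ` for the Liouville field `𝓛`. -/
theorem mlieBracket_geodesicField_liouvilleField (hp : p ∈ slit E M) :
    VectorField.mlieBracket 𝓘(ℝ, E).tangent F.geodesicField liouvilleField p =
      -F.geodesicField p := by
  have ev := F.eventually_localField_geodesicField hp
  have e1 : localField F.geodesicField p =ᶠ[nhds (coord p)]
      fun z => (z.2, sprayCoeff (F.coordSq p) z) := ev.mono fun z h => h.2.2.2
  have e2 : localField (liouvilleField (E := E) (M := M)) p =ᶠ[nhds (coord p)]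
      fun z => (0, z.2) := by
    filter_upwards [extChartAt_target_mem_nhds (I := 𝓘(ℝ, E).tangent) p] with z hz
      using localField_liouvilleField hz
  have hhom : ∀ᶠ c in nhds (1 : ℝ), sprayCoeff (F.coordSq p) ((coord p).1, c • (coord p).2) =
      c ^ 2 • sprayCoeff (F.coordSq p) (coord p) := by
    have hc := (hasDerivAt_fiber_smul (coord p)).continuousAt
    have ht : Filter.Tendsto (fun c : ℝ => (((coord p).1, c • (coord p).2) : E × E)) (nhds 1)
      (nhds (coord p)) := by simpa [ContinuousAt] using hc
    filter_upwards [ht.eventually ev, lt_mem_nhds (zero_lt_one' ℝ)] with c h hc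
    -- The scaled solution solves the equation at the scaled point, so uniqueness there forces
    -- homogeneity of degree two.
    have h1 := ev.self_of_nhds.1.smul (F.isHomogeneousTwo_coordSq p) hc
    have h2 := h1.eq_sprayCoeff h.2.1 rfl h.2.2.1
    exact (congrArg Prod.snd h2).symm
  have hself : F.geodesicField p = ((coord p).2, sprayCoeff (F.coordSq p) (coord p)) :=
    (F.isSprayAt_geodesicField hp).eq_sprayCoeff ev.self_of_nhds.2.1
      (by rw [geodesicField_eq]) ev.self_of_nhds.2.2.1
  have h3 := lieBracket_spray_liouville
    ((F.contDiffAt_sprayCoeff_coordSq hp).differentiableAt (by simp)) hhom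
  rw [mlieBracket_eq_lieBracket_localField, hself]
  exact (e1.lieBracket_vectorField_eq e2).trans h3

/-- The geodesic field annihilates the functions of `F`. -/
theorem dirDeriv_geodesicField_eq_zero (hp : p ∈ slit E M) {h : TangentBundle 𝓘(ℝ, E) M → ℝ}
    {k : ℝ → ℝ} (hk : ∀ q ∈ slit E M, h q = k (F.toFun q ^ 2)) :
    dirDeriv h p (F.geodesicField p) = 0 := by
  -- Nothing is assumed about `k`; where `h` is not differentiable, `mfderiv` is `0` by convention.
  by_cases hd : MDifferentiableAt 𝓘(ℝ, E).tangent 𝓘(ℝ, ℝ) h p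
  · have hr : Set.range 𝓘(ℝ, E).tangent = Set.univ := ModelWithCorners.range_eq_univ _
    have e0 : mfderiv 𝓘(ℝ, E).tangent 𝓘(ℝ, ℝ) h p =
        fderiv ℝ (h ∘ (extChartAt 𝓘(ℝ, E).tangent p).symm) (coord p) := by
      refine hd.mfderiv.trans ?_
      rw [hr, fderivWithin_univ]
      rfl
    have hd' : DifferentiableAt ℝ (h ∘ (extChartAt 𝓘(ℝ, E).tangent p).symm) (coord p) := by
      have := hd.differentiableWithinAt_writtenInExtChartAt
      rw [hr, differentiableWithinAt_univ] at this
      exact this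
    have hs : (extChartAt 𝓘(ℝ, E).tangent p).symm (extChartAt 𝓘(ℝ, E).tangent p p) = p :=
      extChartAt_to_inv p
    have ev1 : ∀ᶠ z in nhds (coord p), (extChartAt 𝓘(ℝ, E).tangent p).symm z ∈ slit E M := by
      have hc := continuousAt_extChartAt_symm (I := 𝓘(ℝ, E).tangent) p
      refine hc.eventually ?_
      rw [hs]
      exact slit_mem_nhds hp
    rw [dirDeriv, e0]
    refine fderiv_eq_zero_of_eq_comp (F.isHomogeneousTwo_coordSq p) (k := k)
      ((F.contDiffAt_coordSq hp).differentiableAt (by simp))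
      (by rw [coordSq_coord]; exact F.sq_pos hp) hd' (ev1.mono fun z hz => hk _ hz) ?_
    rw [geodesicField_eq]
    exact (F.isChernSymbol_chernSymbol hp).fderiv_horizontal (F.isHomogeneousTwo_coordSq p)
      (F.contDiffAt_coordSq hp) _
  · rw [dirDeriv, mfderiv_zero_of_not_mdifferentiableAt hd]
    rfl

end FinslerNorm

/-! ### The contradiction with nondegeneracy. -/

/-- Every tangent vector of `TM` is the sum of a horizontal and a vertical lift. -/
theorem exists_eq_horizontalLift_add_verticalLift [FiniteDimensional ℝ E] (F : FinslerNorm E M)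
    (p : TangentBundle 𝓘(ℝ, E) M) (w : TangentSpace 𝓘(ℝ, E).tangent p) :
    ∃ X Y : TangentSpace 𝓘(ℝ, E) p.proj, w = F.horizontalLift p X + verticalLift p Y := by
  refine ⟨(show E × E from w).1,
    (show E × E from w).2 + F.chernSymbol p ((show E × E from w).1, 0) p.2, ?_⟩
  refine Prod.ext (add_zero _).symm ?_
  exact (neg_add_cancel_comm_assoc _ _).symm

/-- The geodesic field is not conformal for an `F`-natural metric, whatever the potential. -/
theorem not_hasPotential_geodesicField [FiniteDimensional ℝ E] [Nontrivial E] [Nonempty M]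
    (F : FinslerNorm E M)
    (G : ∀ p : TangentBundle 𝓘(ℝ, E) M, TangentSpace 𝓘(ℝ, E).tangent p →L[ℝ]
      TangentSpace 𝓘(ℝ, E).tangent p →L[ℝ] ℝ)
    (hG : IsPseudoRiemannianMetric G) (hnat : IsFNatural F G)
    (f : TangentBundle 𝓘(ℝ, E) M → ℝ) : ¬ HasPotential G F.geodesicField f := by
  intro hf
  obtain ⟨v, hv⟩ := exists_ne (0 : E)
  obtain ⟨p, hp⟩ : (slit E M).Nonempty := ⟨⟨Classical.arbitrary M, v⟩, hv⟩
  obtain ⟨α₁, α₂, α₃, β₁, β₂, β₃, h⟩ := hnat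
  have hvv : ∀ q ∈ slit E M, G q (liouvilleField q) (liouvilleField q) =
      (fun s => α₁ s * s + β₁ s * (s * s)) (F.toFun q ^ 2) := fun q hq => by
    have := (h q hq q.2 q.2).2.2
    rw [F.g_self hq] at this
    exact this
  have hhv : ∀ q ∈ slit E M, G q (F.geodesicField q) (liouvilleField q) =
      (fun s => α₂ s * s + β₂ s * (s * s)) (F.toFun q ^ 2) := fun q hq => by
    have := (h q hq q.2 q.2).2.1
    rw [F.g_self hq] at this
    exact this
  have hhh : ∀ q ∈ slit E M, G q (F.geodesicField q) (F.geodesicField q) =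
      (fun s => (α₁ s + α₃ s) * s + (β₁ s + β₃ s) * (s * s)) (F.toFun q ^ 2) := fun q hq => by
    have := (h q hq q.2 q.2).1
    rw [F.g_self hq] at this
    exact this
  have hvh : ∀ q ∈ slit E M, G q (liouvilleField q) (F.geodesicField q) =
      (fun s => α₂ s * s + β₂ s * (s * s)) (F.toFun q ^ 2) := fun q hq => by
    rw [hG.symm q hq, hhv q hq]
  have br := F.mlieBracket_geodesicField_liouvilleField hp
  have br0 : VectorField.mlieBracket 𝓘(ℝ, E).tangent F.geodesicField F.geodesicField p = 0 := by
    rw [VectorField.mlieBracket_self]; rfl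
  -- After simplification these three tests read `2B = 2fA`, `C = 2fB` and `0 = 2fC` at the single
  -- point `p`.
  have k1 := hf _ _ isSmoothField_liouvilleField isSmoothField_liouvilleField p hp
  have k2 := hf _ _ isSmoothField_liouvilleField F.isSmoothField_geodesicField p hp
  have k3 := hf _ _ F.isSmoothField_geodesicField F.isSmoothField_geodesicField p hp
  rw [lieDerivative, F.dirDeriv_geodesicField_eq_zero hp (k := fun s => α₁ s * s + β₁ s * (s * s))
    hvv, br] at k1
  rw [lieDerivative, F.dirDeriv_geodesicField_eq_zero hp (k := fun s => α₂ s * s + β₂ s * (s * s))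
    hvh, br, br0] at k2
  rw [lieDerivative, F.dirDeriv_geodesicField_eq_zero hp
    (k := fun s => (α₁ s + α₃ s) * s + (β₁ s + β₃ s) * (s * s))
    hhh, br0] at k3
  simp only [map_neg, neg_apply, map_zero, zero_apply] at k1 k2 k3
  rw [hG.symm p hp (liouvilleField p)] at k1 k2
  set A := G p (liouvilleField p) (liouvilleField p)
  have hB := hhv p hp
  have hC := hhh p hp
  set B := G p (F.geodesicField p) (liouvilleField p)
  set C := G p (F.geodesicField p) (F.geodesicField p)
  have hBC : B = 0 ∧ C = 0 := by
    rcases eq_or_ne (f p) 0 with h0 | h0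
    · rw [h0] at k1 k2
      exact ⟨by linarith, by linarith⟩
    · have hC0 : C = 0 := by
        have : f p * C = 0 := by linarith
        exact (mul_eq_zero.1 this).resolve_left h0
      have : f p * B = 0 := by linarith
      exact ⟨(mul_eq_zero.1 this).resolve_left h0, hC0⟩
  rw [hBC.1] at hB
  rw [hBC.2] at hC
  have hs := F.sq_pos hp
  have hg := F.g_self hp
  set s := F.toFun p ^ 2
  -- This and `hc` are the coefficients of `g_u(u, Y)` in `G(ζ, Y^v)` and of `g_u(u, X)` in `G(ζ,
  -- X^h)`; they vanish because `B` and `C` are `s` times them, with `s > 0`.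
  have hb : α₂ s + β₂ s * s = 0 := by
    have : s * (α₂ s + β₂ s * s) = 0 := by linear_combination -hB
    exact (mul_eq_zero.1 this).resolve_left hs.ne'
  have hc : α₁ s + α₃ s + (β₁ s + β₃ s) * s = 0 := by
    have : s * (α₁ s + α₃ s + (β₁ s + β₃ s) * s) = 0 := by linear_combination -hC
    exact (mul_eq_zero.1 this).resolve_left hs.ne'
  have hzero : F.geodesicField p = 0 := by
    refine hG.nondegenerate p hp _ fun w => ?_
    obtain ⟨X, Y, rfl⟩ := exists_eq_horizontalLift_add_verticalLift F p w
    have h1 : G p (F.geodesicField p) (F.horizontalLift p X) = 0 := by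
      refine (h p hp p.2 X).1.trans ?_
      rw [hg, F.g_symm hp X]
      linear_combination F.g p p.2 X * hc
    have h2 : G p (F.geodesicField p) (verticalLift p Y) = 0 := by
      refine (h p hp p.2 Y).2.1.trans ?_
      rw [hg, F.g_symm hp Y]
      linear_combination F.g p p.2 Y * hb
    rw [map_add, h1, h2, add_zero]
  -- The base component of `ζ` at `(x,u)` is `u`, which is nonzero on the slit bundle.
  exact hp (congrArg Prod.fst hzero)

end SlitTangentBundle

end FinslerGeometry

end

open FinslerGeometry
theorem mainTheorem6 {E : Type*} [NormedAddCommGroup E] [NormedSpace ℝ E] [FiniteDimensional ℝ E]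
    [Nontrivial E] {M : Type*} [TopologicalSpace M] [ChartedSpace E M] [IsManifold 𝓘(ℝ, E) ∞ M]
    [T2Space M] [SecondCountableTopology M] [ConnectedSpace M] (F : FinslerNorm E M)
    (G : ∀ p : TangentBundle 𝓘(ℝ, E) M, TangentSpace 𝓘(ℝ, E).tangent p →L[ℝ]
      TangentSpace 𝓘(ℝ, E).tangent p →L[ℝ] ℝ)
    (hG : IsPseudoRiemannianMetric G) (hnat : IsFNatural F G) :
    ¬ IsConformal G F.geodesicField ∧ ¬ IsHomothetic G F.geodesicField ∧
      ¬ IsKilling G F.geodesicField :=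
  ⟨fun ⟨f, _, hf⟩ => not_hasPotential_geodesicField F G hG hnat f hf,
    fun ⟨_, hc⟩ => not_hasPotential_geodesicField F G hG hnat _ hc,
    not_hasPotential_geodesicField F G hG hnat _⟩
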